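/- Conventions. A \emph{state} on a unital complex $*$-algebra is a unital linear functional $\varphi$ with $\varphi(x^*x)\ge 0$ for all $x$. Let $\nu_1,\nu_2$ be compactly supported probability measures on $\mathbb R$. A \emph{free additive convolution} $\nu_1\boxplus\nu_2$ is a compactly supported probability measure $\nu$ on $\mathbb R$ such that, for some unital $*$-algebra $\mathcal A$ with a state $\varphi$ and some self-adjoint $x_1,x_2\in\mathcal A$ that are free (contained in unital $*$-subalgebras $\mathcal B_1,\mathcal B_2$ such that $\varphi(y_1\cdots y_m)=0$ whenever $m\ge 1$, $y_j\in\mathcal B_{i_j}$, $\varphi(y_j)=0$ and $i_1\ne i_2\ne\cdots\ne i_m$), one has $\varphi(x_i^n)=\int t^n\,d\nu_i(t)$ for $i=1,2$ and $\varphi((x_1+x_2)^n)=\int t^n\,d\nu(t)$, for all $n\ge 0$. A \emph{$(\rho_1,\rho_2)$-rectangular probability space} is a unital complex $*$-algebra $\mathcal A$ with nonzero self-adjoint projectors $p_1,p_2$ such that $p_1p_2=p_2p_1=0$ and $p_1+p_2=1$, and with tracial states $\varphi_k$ on the $*$-algebras $p_k\mathcal A p_k$ (with unit $p_k$) such that $\rho_k\varphi_k(xy)=\rho_l\varphi_l(yx)$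 for all $k,l\in\{1,2\}$, $x\in p_k\mathcal A p_l$, $y\in p_l\mathcal A p_k$. Put $\mathcal D=\mathbb Cp_1+\mathbb Cp_2$ and $\mathrm E(x)=\varphi_1(p_1xp_1)p_1+\varphi_2(p_2xp_2)p_2$. Elements $a_1,a_2$ are \emph{free with amalgamation over $\mathcal D$} if they are contained in $*$-subalgebras $\mathcal B_1,\mathcal B_2\supset\mathcal D$ such that $\mathrm E(y_1\cdots y_m)=0$ whenever $m\ge 1$, $y_j\in\mathcal B_{i_j}$, $\mathrm E(y_j)=0$ and $i_1\ne i_2\ne\cdots\ne i_m$. Let $\mu_1,\mu_2$ be compactly supported symmetric probability measures on $\mathbb R$. A \emph{rectangular free convolution with ratio $\lambda$}, $\mu_1\boxplus_\lambda\mu_2$, is a compactly supported symmetric probability measure $\mu$ on $\mathbb R$ such that, for some $(\rho_1,\rho_2)$-rectangular probability space with $\rho_1+\rho_2=1$, $\rho_1/\rho_2=\lambda$, and some $a_1,a_2\in p_1\mathcal A p_2$ free with amalgamation over $\mathcal D$, one has $\varphi_1((a_ia_i^*)^n)=\int t^{2n}\,d\mu_i(t)$ for $i=1,2$ and $\varphi_1(((a_1+a_2)(a_1+a_2)^*)^n)=\int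 t^{2n}\,d\mu(t)$, for all $n\ge 0$. \textbf{Proposition.} Let $\mu_1,\mu_2$ be compactly supported symmetric probability measures on $\mathbb R$, and for a measure $\mu$ on $\mathbb R$ let $\mu^{2}$ denote its push-forward by $x\mapsto x^2$. Then the rectangular free convolution with ratio zero $\mu_1\boxplus_0\mu_2$ and the free additive convolution $\mu_1^{2}\boxplus\mu_2^{2}$ exist and are unique, and $\mu_1\boxplus_0\mu_2$ is the unique symmetric probability measure $\mu$ on $\mathbb R$ such that $\mu^{2}=\mu_1^{2}\boxplus\mu_2^{2}$. -/

import Mathlib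

open MeasureTheory

/-- `μ` is carried by a compact set. -/
def IsCompactlySupported (μ : Measure ℝ) : Prop :=
  ∃ K : Set ℝ, IsCompact K ∧ μ Kᶜ = 0

/-- `μ` is symmetric: `μ(-B) = μ(B)` for every Borel set `B`. -/
def IsSymmetricMeasure (μ : Measure ℝ) : Prop :=
  μ.map (fun x : ℝ => -x) = μ

/-- The push-forward of `μ` by the square function. -/
noncomputable def sqPush (μ : Measure ℝ) : Measure ℝ :=
  μ.map (fun x : ℝ => x ^ 2)

/-- The vanishing condition of freeness for a family of `*`-subalgebras with respect to a linear
map `E` (a state, or a conditional expectation): for every `m ≥ 1`, if `x₁, …, x_m` are taken from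
subalgebras with consecutive indices distinct and `E x₁ = ⋯ = E x_m = 0`, then
`E (x₁ ⋯ x_m) = 0`. A list of pairs (index, element) encodes the `x_j` with their indices. -/
def IsFreeFamily {ι A M : Type*} [Ring A] [StarRing A] [Algebra ℂ A] [StarModule ℂ A]
    [AddCommGroup M] [Module ℂ M] (E : A →ₗ[ℂ] M) (B : ι → StarSubalgebra ℂ A) : Prop :=
  ∀ l : List (ι × A), l ≠ [] →
    (l.map Prod.fst).IsChain (fun i j => i ≠ j) →
    (∀ q ∈ l, q.2 ∈ B q.1 ∧ E q.2 = 0) →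
    E (l.map Prod.snd).prod = 0

/-- A state on a unital complex `*`-algebra: a positive unital linear functional. -/
structure IsStarState {A : Type*} [Ring A] [StarRing A] [Algebra ℂ A] [StarModule ℂ A]
    (φ : A →ₗ[ℂ] ℂ) : Prop where
  map_one : φ 1 = 1
  pos : ∀ x : A, 0 ≤ (φ (star x * x)).re ∧ (φ (star x * x)).im = 0

/-- `ν = ν₁ ⊞ ν₂`, for compactly supported measures: `ν` is the compactly supported probability
measure which is the distribution of `x₁ + x₂`, where `x₁, x₂` are free self-adjoint elements of a
`*`-probability space with respective distributions `ν₁, ν₂`. -/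
def IsFreeConvolution (ν₁ ν₂ ν : Measure ℝ) : Prop :=
  IsProbabilityMeasure ν ∧ IsCompactlySupported ν ∧
  ∃ (A : Type) (_ : Ring A) (_ : StarRing A) (_ : Algebra ℂ A) (_ : StarModule ℂ A)
    (φ : A →ₗ[ℂ] ℂ) (x : Fin 2 → A),
    IsStarState φ ∧
    (∀ i, star (x i) = x i) ∧
    (∃ B : Fin 2 → StarSubalgebra ℂ A, (∀ i, x i ∈ B i) ∧ IsFreeFamily φ B) ∧
    (∀ n : ℕ, φ (x 0 ^ n) = ((∫ t, t ^ n ∂ν₁ : ℝ) : ℂ)) ∧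
    (∀ n : ℕ, φ (x 1 ^ n) = ((∫ t, t ^ n ∂ν₂ : ℝ) : ℂ)) ∧
    (∀ n : ℕ, φ ((x 0 + x 1) ^ n) = ((∫ t, t ^ n ∂ν : ℝ) : ℂ))

/-- A `(ρ_1, …, ρ_d)`-rectangular probability space on the `*`-algebra `A`.
A functional on the corner `p_k A p_k` is encoded by its extension `x ↦ φ_k (p_k x p_k)` to `A`;
the field `φ_corner` says that `φ k` is such an extension. -/
structure RectProbSpace {d : ℕ} (ρ : Fin d → ℝ) (A : Type*) [Ring A] [StarRing A] [Algebra ℂ A]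
    [StarModule ℂ A] where
  /-- the projectors -/
  p : Fin d → A
  p_ne_zero : ∀ k, p k ≠ 0
  p_star : ∀ k, star (p k) = p k
  p_idem : ∀ k, p k * p k = p k
  p_orth : ∀ k l, k ≠ l → p k * p l = 0
  p_sum : ∑ k, p k = 1
  /-- the states on the corners -/
  φ : Fin d → A →ₗ[ℂ] ℂ
  φ_corner : ∀ k x, φ k (p k * x * p k) = φ k x
  φ_unit : ∀ k, φ k (p k) = 1
  φ_pos : ∀ k x, x = p k * x * p k →
    0 ≤ (φ k (star x * x)).re ∧ (φ k (star x * x)).im = 0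
  φ_tracial : ∀ k x y, x = p k * x * p k → y = p k * y * p k → φ k (x * y) = φ k (y * x)
  φ_rect : ∀ k l x y, x = p k * x * p l → y = p l * y * p k →
    (ρ k : ℂ) * φ k (x * y) = (ρ l : ℂ) * φ l (y * x)

/-- The conditional expectation `E x = ∑_k φ_k(x_kk) p_k` onto the span `D` of the projectors. -/
noncomputable def RectProbSpace.condExpD {d : ℕ} {ρ : Fin d → ℝ} {A : Type*} [Ring A] [StarRing A]
    [Algebra ℂ A] [StarModule ℂ A] (S : RectProbSpace ρ A) : A →ₗ[ℂ] A :=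
  ∑ k, (S.φ k).smulRight (S.p k)

/-- The elements `a_i` are free with amalgamation over `D`: they lie in `*`-subalgebras which
contain `D` (that is, contain every projector) and are free with amalgamation over `D`. -/
def RectProbSpace.FreeOverD {d : ℕ} {ρ : Fin d → ℝ} {A : Type*} [Ring A] [StarRing A]
    [Algebra ℂ A] [StarModule ℂ A] (S : RectProbSpace ρ A) {ι : Type*} (a : ι → A) : Prop :=
  ∃ B : ι → StarSubalgebra ℂ A,
    (∀ i, a i ∈ B i) ∧ (∀ i k, S.p k ∈ B i) ∧ IsFreeFamily S.condExpD B

/-- `μ` is the rectangular free convolution with ratio `lam` of `μ₁` and `μ₂` (compactly supported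
symmetric probability measures): `μ` is the compactly supported symmetric probability measure whose
even moments are `φ_1(((a_1 + a_2)(a_1 + a_2)*)^n)`, where `a_1, a_2 ∈ p_1 A p_2` are free with
amalgamation over `D` in a `(ρ_1, ρ_2)`-rectangular probability space and the even moments of `μ_i`
are `φ_1((a_i a_i*)^n)`. Here `ρ_1 + ρ_2 = 1` and `ρ_1 / ρ_2 = lam`. The indices `1, 2` of the
mathematics are `0, 1` in the code. -/
def IsRectFreeConvolution (lam : ℝ) (μ₁ μ₂ μ : Measure ℝ) : Prop :=
  IsProbabilityMeasure μ ∧ IsCompactlySupported μ ∧ IsSymmetricMeasure μ ∧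
  ∃ (A : Type) (_ : Ring A) (_ : StarRing A) (_ : Algebra ℂ A) (_ : StarModule ℂ A)
    (S : RectProbSpace ![lam / (1 + lam), 1 / (1 + lam)] A) (a : Fin 2 → A),
    (∀ i, a i = S.p 0 * a i * S.p 1) ∧
    S.FreeOverD a ∧
    (∀ n : ℕ, S.φ 0 ((a 0 * star (a 0)) ^ n) = ((∫ t, t ^ (2 * n) ∂μ₁ : ℝ) : ℂ)) ∧
    (∀ n : ℕ, S.φ 0 ((a 1 * star (a 1)) ^ n) = ((∫ t, t ^ (2 * n) ∂μ₂ : ℝ) : ℂ)) ∧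
    (∀ n : ℕ, S.φ 0 (((a 0 + a 1) * star (a 0 + a 1)) ^ n)
      = ((∫ t, t ^ (2 * n) ∂μ : ℝ) : ℂ))

/-! Indices here are 0 and 1, so ratio zero means `ρ 0 = 0` and `ρ 1 = 1`. The relation between the
two corner states then forces `φ 1` to vanish on every product `y * x` with `x ∈ p₀Ap₁`, `y ∈
p₁Ap₀`. In particular `a₀* a₀` is centred over `D`, so `a₁ (a₀* a₀) a₁*` is an alternating product
of centred elements and the cross term `d = a₀ a₁*` satisfies `φ 0 (d* d) = 0` (`φ_mixed_null`).
Positivity and the trace property make `d` and `d*` invisible in all moments, so `(a₀ + a₁)(a₀ +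
a₁)*` has the moments of `a₀ a₀* + a₁ a₁*`, a sum of two elements free for `φ 0`. Thus the square of
a rectangular convolution is the free convolution of the squares
(`IsRectFreeConvolution.isFreeConvolution`).

Uniqueness: freeness determines the moments of a sum (`moments_add_eq_of_free`), moments determine a
compactly supported measure (`ext_of_moments`), and a symmetric compactly supported measure is
determined by its square (`IsSymmetricMeasure.ext_of_sqPush`).

Existence: free self-adjoint operators `x₀, x₁` with laws `μ₁, μ₂` are built on a Hilbert space free
product. Over the tracial algebra they generate, the elements `x₀ e₀₁` and `x₁ e₀₂` of a 3 × 3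
matrix algebra are free over `D` and have exactly vanishing cross terms
(`RatioZeroModel.isRectFreeConvolution`). The law of the sum is the symmetrised law of `√(x₀² +
x₁²)`. Existence of the free convolution follows from the first paragraph, and the converse half of
the characterisation from uniqueness. -/

set_option linter.unusedSectionVars false

/-! ### Alternating centred words in a free family, and traciality. -/

section NormalForm

variable {ι A : Type*} [Ring A] [StarRing A] [Algebra ℂ A] [StarModule ℂ A]

/-- The words with consecutive indices distinct whose letters are centred elements of the
subalgebras. -/
def centeredWords (E : A →ₗ[ℂ] ℂ) (B : ι → StarSubalgebra ℂ A) : Set (List (ι × A)) :=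
  {l | (l.map Prod.fst).IsChain (fun i j => i ≠ j) ∧ ∀ q ∈ l, q.2 ∈ B q.1 ∧ E q.2 = 0}

/-- The product of the letters of a word. -/
def wordProd (l : List (ι × A)) : A := (l.map Prod.snd).prod

/-- The span of the products of centred alternating words. -/
def alternatingSpan (E : A →ₗ[ℂ] ℂ) (B : ι → StarSubalgebra ℂ A) : Submodule ℂ A :=
  Submodule.span ℂ (wordProd '' centeredWords E B)

variable {E : A →ₗ[ℂ] ℂ} {B : ι → StarSubalgebra ℂ A}

theorem nil_mem_centeredWords : [] ∈ centeredWords E B := by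
  simp [centeredWords]

theorem wordProd_mem_alternatingSpan {l : List (ι × A)} (hl : l ∈ centeredWords E B) :
    wordProd l ∈ alternatingSpan E B :=
  Submodule.subset_span ⟨l, hl, rfl⟩

theorem one_mem_alternatingSpan : (1 : A) ∈ alternatingSpan E B :=
  wordProd_mem_alternatingSpan (l := []) nil_mem_centeredWords

theorem cons_mem_centeredWords {k : ι} {y : A} {l : List (ι × A)} (hl : l ∈ centeredWords E B)
    (hy : y ∈ B k) (hE : E y = 0) (hk : ∀ q ∈ l.head?, k ≠ q.1) :
    (k, y) :: l ∈ centeredWords E B := by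
  refine ⟨?_, ?_⟩
  · rw [List.map_cons, List.isChain_cons]
    refine ⟨?_, hl.1⟩
    intro j hj
    rw [List.head?_map] at hj
    obtain ⟨q, hq, rfl⟩ := Option.mem_map.1 hj
    exact hk q hq
  · intro q hq
    rcases List.mem_cons.1 hq with rfl | hq
    · exact ⟨hy, hE⟩
    · exact hl.2 q hq

theorem tail_mem_centeredWords {q : ι × A} {l : List (ι × A)}
    (hl : q :: l ∈ centeredWords E B) : l ∈ centeredWords E B := by
  refine ⟨?_, fun r hr => hl.2 r (List.mem_cons_of_mem _ hr)⟩
  have := hl.1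
  rw [List.map_cons] at this
  exact this.of_cons

theorem head_ne_of_mem_centeredWords {q : ι × A} {l : List (ι × A)}
    (hl : q :: l ∈ centeredWords E B) : ∀ r ∈ l.head?, q.1 ≠ r.1 := by
  intro r hr
  have := hl.1
  rw [List.map_cons, List.isChain_cons] at this
  refine this.1 _ ?_
  rw [List.head?_map]
  exact Option.mem_map.2 ⟨r, hr, rfl⟩

/-- The centred part of an element. -/
theorem sub_algebraMap_mem (h1 : E 1 = 1) {k : ι} {y : A} (hy : y ∈ B k) :
    y - algebraMap ℂ A (E y) ∈ B k ∧ E (y - algebraMap ℂ A (E y)) = 0 := by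
  refine ⟨sub_mem hy ((B k).algebraMap_mem _), ?_⟩
  rw [Algebra.algebraMap_eq_smul_one, map_sub, map_smul, h1]
  simp

theorem mul_wordProd_eq {k : ι} (y : A) (l : List (ι × A)) :
    y * wordProd l = E y • wordProd l + wordProd ((k, y - algebraMap ℂ A (E y)) :: l) := by
  simp [wordProd, sub_mul, Algebra.algebraMap_eq_smul_one]

/-- Split the new letter into its mean and its centred part. If the word already starts in the same
subalgebra, merge the new letter with the first one before splitting; the tail then starts in a
different subalgebra. -/
theorem mul_mem_alternatingSpan (h1 : E 1 = 1) {k : ι} {y n : A} (hy : y ∈ B k)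
    (hn : n ∈ alternatingSpan E B) : y * n ∈ alternatingSpan E B := by
  have key : ∀ (l : List (ι × A)) (z : A), l ∈ centeredWords E B → z ∈ B k →
      (∀ q ∈ l.head?, k ≠ q.1) → z * wordProd l ∈ alternatingSpan E B := by
    intro l z hl hz hk
    rw [mul_wordProd_eq (E := E) (k := k)]
    obtain ⟨hc, hc'⟩ := sub_algebraMap_mem (B := B) h1 hz
    exact add_mem (Submodule.smul_mem _ _ (wordProd_mem_alternatingSpan hl))
      (wordProd_mem_alternatingSpan (cons_mem_centeredWords hl hc hc' hk))
  induction hn using Submodule.span_induction with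
  | zero => simp
  | add u v _ _ hu hv => rw [mul_add]; exact add_mem hu hv
  | smul c u _ hu => rw [mul_smul_comm]; exact Submodule.smul_mem _ _ hu
  | mem u hu =>
    obtain ⟨l, hl, rfl⟩ := hu
    by_cases hk : ∀ q ∈ l.head?, k ≠ q.1
    · exact key l y hl hy hk
    · push Not at hk
      obtain ⟨q, hq, rfl⟩ := hk
      obtain ⟨t, rfl⟩ : ∃ t, l = q :: t := by
        cases l with
        | nil => simp at hq
        | cons a t => simp at hq; exact ⟨t, by rw [hq]⟩
      have : y * wordProd (q :: t) = (y * q.2) * wordProd t := by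
        simp [wordProd, mul_assoc]
      rw [this]
      exact key t _ (tail_mem_centeredWords hl) (mul_mem hy (hl.2 q (by simp)).1)
        (head_ne_of_mem_centeredWords hl)

/-- The span contains 1 and is stable under left multiplication by each generator, hence by
everything the generators generate. -/
theorem adjoin_le_alternatingSpan (h1 : E 1 = 1) {s : Set A} (hs : ∀ x ∈ s, ∃ k, x ∈ B k) {u : A}
    (hu : u ∈ Algebra.adjoin ℂ s) : u ∈ alternatingSpan E B := by
  suffices h : ∀ n ∈ alternatingSpan E B, u * n ∈ alternatingSpan E B by
    simpa using h 1 one_mem_alternatingSpan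
  induction hu using Algebra.adjoin_induction with
  | mem x hx =>
    obtain ⟨k, hk⟩ := hs x hx
    exact fun n hn => mul_mem_alternatingSpan h1 hk hn
  | algebraMap r =>
    intro n hn
    rw [← Algebra.smul_def]
    exact Submodule.smul_mem _ _ hn
  | add x y _ _ hx hy =>
    intro n hn
    rw [add_mul]
    exact add_mem (hx n hn) (hy n hn)
  | mul x y _ _ hx hy =>
    intro n hn
    rw [mul_assoc]
    exact hx _ (hy n hn)

theorem IsFreeFamily.apply_wordProd (hF : IsFreeFamily E B) {l : List (ι × A)}
    (hl : l ∈ centeredWords E B) (hne : l ≠ []) : E (wordProd l) = 0 :=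
  hF l hne hl.1 hl.2

theorem IsFreeFamily.apply_mul_wordProd (hF : IsFreeFamily E B) (h1 : E 1 = 1) {k : ι} {z : A}
    (hz : z ∈ B k) {l : List (ι × A)} (hl : l ∈ centeredWords E B) (hne : l ≠ [])
    (hk : ∀ q ∈ l.head?, k ≠ q.1) : E (z * wordProd l) = 0 := by
  obtain ⟨hc, hc'⟩ := sub_algebraMap_mem (B := B) h1 hz
  rw [mul_wordProd_eq (E := E) (k := k), map_add, map_smul, hF.apply_wordProd hl hne,
    hF.apply_wordProd (cons_mem_centeredWords hl hc hc' hk) (by simp)]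
  simp

theorem append_mem_centeredWords {k : ι} {y : A} {l : List (ι × A)} (hl : l ∈ centeredWords E B)
    (hy : y ∈ B k) (hE : E y = 0) (hk : ∀ q ∈ l.getLast?, q.1 ≠ k) :
    l ++ [(k, y)] ∈ centeredWords E B := by
  refine ⟨?_, ?_⟩
  · rw [List.map_append, List.isChain_append]
    refine ⟨hl.1, by simp, ?_⟩
    intro i hi j hj
    rw [List.getLast?_map] at hi
    obtain ⟨q, hq, rfl⟩ := Option.mem_map.1 hi
    simp only [List.map_cons, List.map_nil, List.head?_cons, Option.mem_def,
      Option.some.injEq] at hj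
    exact hj ▸ hk q hq
  · intro q hq
    rcases List.mem_append.1 hq with hq | hq
    · exact hl.2 q hq
    · obtain rfl := List.mem_singleton.1 hq
      exact ⟨hy, hE⟩

theorem IsFreeFamily.apply_wordProd_mul (hF : IsFreeFamily E B) (h1 : E 1 = 1) {k : ι} {z : A}
    (hz : z ∈ B k) {l : List (ι × A)} (hl : l ∈ centeredWords E B) (hne : l ≠ [])
    (hk : ∀ q ∈ l.getLast?, q.1 ≠ k) : E (wordProd l * z) = 0 := by
  obtain ⟨hc, hc'⟩ := sub_algebraMap_mem (B := B) h1 hz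
  have : wordProd l * z
      = E z • wordProd l + wordProd (l ++ [(k, z - algebraMap ℂ A (E z))]) := by
    simp [wordProd, mul_sub, Algebra.algebraMap_eq_smul_one]
  rw [this, map_add, map_smul, hF.apply_wordProd hl hne,
    hF.apply_wordProd (append_mem_centeredWords hl hc hc' hk) (by simp)]
  simp

theorem init_mem_centeredWords {q : ι × A} {l : List (ι × A)}
    (hl : l ++ [q] ∈ centeredWords E B) :
    l ∈ centeredWords E B ∧ ∀ r ∈ l.getLast?, r.1 ≠ q.1 := by
  have h := hl.1
  rw [List.map_append, List.isChain_append] at h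
  refine ⟨⟨h.1, fun r hr => hl.2 r (List.mem_append_left _ hr)⟩, fun r hr => ?_⟩
  refine h.2.2 _ ?_ _ (by simp)
  rw [List.getLast?_map]
  exact Option.mem_map.2 ⟨r, hr, rfl⟩

/-- Merging `z` with the first letter uses up at most one letter, so a nonempty centred alternating
tail survives. -/
theorem IsFreeFamily.apply_mul_wordProd_of_two_le (hF : IsFreeFamily E B) (h1 : E 1 = 1) {k : ι}
    {z : A} (hz : z ∈ B k) {l : List (ι × A)} (hl : l ∈ centeredWords E B) (hlen : 2 ≤ l.length) :
    E (z * wordProd l) = 0 := by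
  obtain ⟨q, t, rfl⟩ : ∃ q t, l = q :: t := by
    cases l with
    | nil => simp at hlen
    | cons q t => exact ⟨q, t, rfl⟩
  by_cases hk : k = q.1
  · subst hk
    have : z * wordProd (q :: t) = (z * q.2) * wordProd t := by simp [wordProd, mul_assoc]
    rw [this]
    refine hF.apply_mul_wordProd h1 (mul_mem hz (hl.2 q (by simp)).1) (tail_mem_centeredWords hl)
      ?_ (head_ne_of_mem_centeredWords hl)
    rintro rfl
    simp at hlen
  · exact hF.apply_mul_wordProd h1 hz hl (by simp) (by simpa using hk)

theorem IsFreeFamily.apply_wordProd_mul_of_two_le (hF : IsFreeFamily E B) (h1 : E 1 = 1) {k : ι}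
    {z : A} (hz : z ∈ B k) {l : List (ι × A)} (hl : l ∈ centeredWords E B) (hlen : 2 ≤ l.length) :
    E (wordProd l * z) = 0 := by
  obtain ⟨t, q, rfl⟩ : ∃ t q, l = t ++ [q] := by
    rcases List.eq_nil_or_concat l with rfl | ⟨t, q, h⟩
    · simp at hlen
    · exact ⟨t, q, by simpa using h⟩
  by_cases hk : q.1 = k
  · subst hk
    have : wordProd (t ++ [q]) * z = wordProd t * (q.2 * z) := by simp [wordProd, mul_assoc]
    rw [this]
    refine hF.apply_wordProd_mul h1 (mul_mem (hl.2 q (by simp)).1 hz) (init_mem_centeredWords hl).1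
      ?_ (init_mem_centeredWords hl).2
    rintro rfl
    simp at hlen
  · exact hF.apply_wordProd_mul h1 hz hl (by simp) (by simpa using hk)

/-- A functional which is tracial on each member of a free family is tracial on the algebra
which they generate. -/
theorem IsFreeFamily.apply_mul_comm (hF : IsFreeFamily E B) (h1 : E 1 = 1)
    (htr : ∀ k, ∀ u ∈ B k, ∀ v ∈ B k, E (u * v) = E (v * u)) {s : Set A}
    (hs : ∀ x ∈ s, ∃ k, x ∈ B k) {u v : A} (hu : u ∈ Algebra.adjoin ℂ s)
    (hv : v ∈ Algebra.adjoin ℂ s) : E (u * v) = E (v * u) := by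
  -- A single element of `B k` against a word: only the empty word and a one-letter word from the
  -- same `B k` can give a nonzero value, and there commutation is trivial or is `htr`. For all
  -- other words both sides vanish.
  have key : ∀ k, ∀ u ∈ B k, ∀ v ∈ alternatingSpan E B, E (u * v) = E (v * u) := by
    intro k u hu v hv
    induction hv using Submodule.span_induction with
    | zero => simp
    | add a b _ _ ha hb => rw [mul_add, add_mul, map_add, map_add, ha, hb]
    | smul c a _ ha => rw [mul_smul_comm, smul_mul_assoc, map_smul, map_smul, ha]
    | mem v hv =>
      obtain ⟨l, hl, rfl⟩ := hv
      rcases l with _ | ⟨q, _ | ⟨r, t⟩⟩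
      · simp [wordProd]
      · by_cases hk : k = q.1
        · subst hk
          simpa [wordProd] using htr _ u hu q.2 (hl.2 q (by simp)).1
        · rw [hF.apply_mul_wordProd h1 hu hl (by simp) (by simpa using hk),
            hF.apply_wordProd_mul h1 hu hl (by simp) (by simpa using Ne.symm hk)]
      · rw [hF.apply_mul_wordProd_of_two_le h1 hu hl (by simp),
          hF.apply_wordProd_mul_of_two_le h1 hu hl (by simp)]
  induction hu using Algebra.adjoin_induction generalizing v with
  | mem x hx =>
    obtain ⟨k, hk⟩ := hs x hx
    exact key k x hk v (adjoin_le_alternatingSpan h1 hs hv)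
  | algebraMap r => rw [Algebra.commutes]
  | add x y _ _ hx hy => rw [add_mul, mul_add, map_add, map_add, hx hv, hy hv]
  | mul x y hx' hy' hx hy =>
    rw [mul_assoc, hx (mul_mem hy' hv), mul_assoc, hy (mul_mem hv hx'), mul_assoc]

end NormalForm

/-! ### Freeness determines the moments of a sum. -/

section MomentUniqueness

variable {A A' : Type*} [Ring A] [StarRing A] [Algebra ℂ A] [StarModule ℂ A]
  [Ring A'] [StarRing A'] [Algebra ℂ A'] [StarModule ℂ A']

theorem mem_adjoin_singleton_iff_of_star_eq {x z : A} (hx : star x = x) :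
    z ∈ StarAlgebra.adjoin ℂ {x} ↔ z ∈ Algebra.adjoin ℂ {x} := by
  rw [← StarSubalgebra.mem_toSubalgebra, StarAlgebra.adjoin_toSubalgebra, Set.star_singleton, hx,
    Set.union_self]

/-- The moments of the sum of two free self-adjoint elements are determined by the moments of
the two elements. -/
theorem moments_add_eq_of_free {φ : A →ₗ[ℂ] ℂ} {φ' : A' →ₗ[ℂ] ℂ} (h1 : φ 1 = 1) (h1' : φ' 1 = 1)
    {x : Fin 2 → A} {x' : Fin 2 → A'} (hx : ∀ i, star (x i) = x i) (hx' : ∀ i, star (x' i) = x' i)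
    {B : Fin 2 → StarSubalgebra ℂ A} {B' : Fin 2 → StarSubalgebra ℂ A'}
    (hB : ∀ i, x i ∈ B i) (hB' : ∀ i, x' i ∈ B' i)
    (hF : IsFreeFamily φ B) (hF' : IsFreeFamily φ' B')
    (hm : ∀ i n, φ (x i ^ n) = φ' (x' i ^ n)) (n : ℕ) :
    φ ((x 0 + x 1) ^ n) = φ' ((x' 0 + x' 1) ^ n) := by
  -- Pairing the two realisations in `A × A'` reduces both to normal form at once: on each `D i` the
  -- functionals agree, so a letter centred for `φ` is also centred for `φ'`, and every nonempty
  -- word vanishes on both sides.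
  let X : Fin 2 → A × A' := fun i => (x i, x' i)
  let D : Fin 2 → StarSubalgebra ℂ (A × A') := fun i => StarAlgebra.adjoin ℂ {X i}
  let ψ : A × A' →ₗ[ℂ] ℂ := φ ∘ₗ LinearMap.fst ℂ A A'
  have hD : ∀ i, ∀ z ∈ D i, z.1 ∈ B i ∧ z.2 ∈ B' i ∧ φ z.1 = φ' z.2 := by
    intro i z hz
    have hXs : star (X i) = X i := Prod.ext (hx i) (hx' i)
    rw [mem_adjoin_singleton_iff_of_star_eq hXs, Algebra.adjoin_singleton_eq_range_aeval] at hz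
    obtain ⟨p, rfl⟩ := hz
    have e1 : ((Polynomial.aeval (X i)) p).1 = Polynomial.aeval (x i) p := by
      simpa using (Polynomial.aeval_algHom_apply (AlgHom.fst ℂ A A') (X i) p).symm
    have e2 : ((Polynomial.aeval (X i)) p).2 = Polynomial.aeval (x' i) p := by
      simpa using (Polynomial.aeval_algHom_apply (AlgHom.snd ℂ A A') (X i) p).symm
    refine ⟨?_, ?_, ?_⟩
    · change ((Polynomial.aeval (X i)) p).1 ∈ B i
      rw [e1]
      exact Algebra.adjoin_le (S := (B i).toSubalgebra) (by simpa using hB i)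
        (Polynomial.aeval_mem_adjoin_singleton ℂ (x i))
    · change ((Polynomial.aeval (X i)) p).2 ∈ B' i
      rw [e2]
      exact Algebra.adjoin_le (S := (B' i).toSubalgebra) (by simpa using hB' i)
        (Polynomial.aeval_mem_adjoin_singleton ℂ (x' i))
    · change φ ((Polynomial.aeval (X i)) p).1 = φ' ((Polynomial.aeval (X i)) p).2
      rw [e1, e2, Polynomial.aeval_eq_sum_range, Polynomial.aeval_eq_sum_range]
      simp [hm]
  have hspan : ∀ z ∈ alternatingSpan ψ D, φ z.1 = φ' z.2 := by
    intro z hz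
    induction hz using Submodule.span_induction with
    | zero => simp
    | add a b _ _ ha hb => simp [ha, hb]
    | smul c a _ ha => simp [ha]
    | mem z hz =>
      obtain ⟨l, hl, rfl⟩ := hz
      rcases eq_or_ne l [] with rfl | hne
      · simp [wordProd, h1, h1']
      have e1 : (wordProd l).1 = wordProd (l.map fun q => (q.1, q.2.1)) := by
        have := map_list_prod (MonoidHom.fst A A') (l.map Prod.snd)
        simpa [wordProd, Function.comp_def] using this
      have e2 : (wordProd l).2 = wordProd (l.map fun q => (q.1, q.2.2)) := by
        have := map_list_prod (MonoidHom.snd A A') (l.map Prod.snd)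
        simpa [wordProd, Function.comp_def] using this
      have m1 : l.map (fun q => (q.1, q.2.1)) ∈ centeredWords φ B := by
        refine ⟨by simpa [Function.comp_def] using hl.1, fun q hq => ?_⟩
        obtain ⟨r, hr, rfl⟩ := List.mem_map.1 hq
        obtain ⟨h, h'⟩ := hl.2 r hr
        exact ⟨(hD _ _ h).1, h'⟩
      have m2 : l.map (fun q => (q.1, q.2.2)) ∈ centeredWords φ' B' := by
        refine ⟨by simpa [Function.comp_def] using hl.1, fun q hq => ?_⟩
        obtain ⟨r, hr, rfl⟩ := List.mem_map.1 hq
        obtain ⟨h, h'⟩ := hl.2 r hr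
        exact ⟨(hD _ _ h).2.1, ((hD _ _ h).2.2).symm.trans h'⟩
      rw [e1, e2, hF.apply_wordProd m1 (by simpa using hne),
        hF'.apply_wordProd m2 (by simpa using hne)]
  have hmem : (X 0 + X 1) ^ n ∈ Algebra.adjoin ℂ (Set.range X) :=
    pow_mem (add_mem (Algebra.subset_adjoin (Set.mem_range_self 0))
      (Algebra.subset_adjoin (Set.mem_range_self 1))) n
  have hXD : ∀ y ∈ Set.range X, ∃ k, y ∈ D k := by
    rintro _ ⟨i, rfl⟩
    exact ⟨i, StarAlgebra.self_mem_adjoin_singleton ℂ _⟩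
  have := hspan _ (adjoin_le_alternatingSpan (E := ψ) h1 hXD hmem)
  simpa [X] using this

end MomentUniqueness

/-! ### Moments, squares and symmetrisation of measures on the line. -/

section Measures

theorem isCompactlySupported_iff {μ : Measure ℝ} :
    IsCompactlySupported μ ↔ ∃ r : ℝ, ∀ᵐ t ∂μ, |t| ≤ r := by
  constructor
  · rintro ⟨K, hK, hμ⟩
    obtain ⟨r, hr⟩ := hK.isBounded.exists_norm_le
    refine ⟨r, ?_⟩
    filter_upwards [show ∀ᵐ t ∂μ, t ∈ K from hμ] with t ht using hr t ht
  · rintro ⟨r, hr⟩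
    refine ⟨Set.Icc (-r) r, isCompact_Icc, ?_⟩
    have : ∀ᵐ t ∂μ, t ∈ Set.Icc (-r) r := by
      filter_upwards [hr] with t ht using abs_le.1 ht
    exact this

/-- Compactly supported finite measures on `ℝ` with the same moments are equal. -/
theorem ext_of_moments {μ ν : Measure ℝ} [IsFiniteMeasure μ] [IsFiniteMeasure ν]
    (hμ : IsCompactlySupported μ) (hν : IsCompactlySupported ν)
    (h : ∀ n : ℕ, ∫ t, t ^ n ∂μ = ∫ t, t ^ n ∂ν) : μ = ν := by
  -- Bounded support allows the exponential series to be integrated term by term, so the complex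
  -- moment generating function is an entire series whose coefficients are the moments.
  have key : ∀ (μ : Measure ℝ) [IsFiniteMeasure μ], IsCompactlySupported μ → ∀ z : ℂ,
      HasSum (fun n : ℕ => z ^ n / (n.factorial : ℂ) * ((∫ t, t ^ n ∂μ : ℝ) : ℂ))
        (ProbabilityTheory.complexMGF id μ z) := by
    intro μ _ hμ z
    obtain ⟨r, hr⟩ := isCompactlySupported_iff.1 hμ
    have := hasSum_integral_of_dominated_convergence (μ := μ)
      (F := fun (n : ℕ) (t : ℝ) => (z * (t : ℂ)) ^ n / (n.factorial : ℂ))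
      (f := fun t : ℝ => Complex.exp (z * t))
      (fun n _ => (‖z‖ * r) ^ n / (n.factorial : ℝ)) (fun n => by fun_prop) ?_ ?_ ?_ ?_
    · have e : ∀ n : ℕ, ∫ t : ℝ, (z * (t : ℂ)) ^ n / (n.factorial : ℂ) ∂μ
          = z ^ n / (n.factorial : ℂ) * ((∫ t, t ^ n ∂μ : ℝ) : ℂ) := by
        intro n
        rw [← integral_complex_ofReal, ← integral_const_mul]
        congr 1
        funext t
        push_cast
        ring
      simp only [e] at this
      exact this
    · intro n
      filter_upwards [hr] with t ht
      rw [norm_div, norm_pow, norm_mul]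
      simp only [Complex.norm_real, Complex.norm_natCast, Real.norm_eq_abs]
      gcongr
    · exact Filter.Eventually.of_forall fun t => Real.summable_pow_div_factorial _
    · exact integrable_const _
    · refine Filter.Eventually.of_forall fun t => ?_
      have := NormedSpace.expSeries_div_hasSum_exp (𝔸 := ℂ) (z * t)
      rwa [← Complex.exp_eq_exp_ℂ] at this
  apply Measure.ext_of_complexMGF_id_eq
  funext z
  refine (key μ hμ z).unique ?_
  simpa only [h] using key ν hν z

theorem integral_pow_sqPush (μ : Measure ℝ) (n : ℕ) :
    ∫ t, t ^ n ∂(sqPush μ) = ∫ t, t ^ (2 * n) ∂μ := by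
  rw [sqPush, integral_map (by fun_prop) (by fun_prop)]
  simp [pow_mul]

theorem isCompactlySupported_sqPush {μ : Measure ℝ} :
    IsCompactlySupported (sqPush μ) ↔ IsCompactlySupported μ := by
  rw [isCompactlySupported_iff, isCompactlySupported_iff]
  have h : ∀ r : ℝ, (∀ᵐ t ∂(sqPush μ), |t| ≤ r) ↔ ∀ᵐ t ∂μ, |t ^ 2| ≤ r := fun r =>
    ae_map_iff (by fun_prop) (measurableSet_le (by fun_prop) (by fun_prop))
  simp only [h]
  constructor
  · rintro ⟨r, hr⟩
    refine ⟨Real.sqrt r, ?_⟩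
    filter_upwards [hr] with t ht
    exact Real.abs_le_sqrt ((le_abs_self _).trans ht)
  · rintro ⟨r, hr⟩
    refine ⟨r ^ 2, ?_⟩
    filter_upwards [hr] with t ht
    rw [abs_pow]
    gcongr

theorem IsSymmetricMeasure.integral_odd_pow {μ : Measure ℝ} (hμ : IsSymmetricMeasure μ) {n : ℕ}
    (hn : Odd n) : ∫ t, t ^ n ∂μ = 0 := by
  have h : ∫ t, t ^ n ∂μ = -∫ t, t ^ n ∂μ := by
    conv_lhs => rw [← hμ, integral_map (by fun_prop) (by fun_prop)]
    simp [hn.neg_pow, integral_neg]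
  linarith

/-- A compactly supported symmetric measure is determined by its image under squaring. -/
theorem IsSymmetricMeasure.ext_of_sqPush {μ ν : Measure ℝ} [IsFiniteMeasure μ] [IsFiniteMeasure ν]
    (hμ : IsSymmetricMeasure μ) (hν : IsSymmetricMeasure ν) (hc : IsCompactlySupported μ)
    (h : sqPush μ = sqPush ν) : μ = ν := by
  refine ext_of_moments hc ?_ fun n => ?_
  · rwa [← isCompactlySupported_sqPush, ← h, isCompactlySupported_sqPush]
  · rcases Nat.even_or_odd' n with ⟨k, rfl | rfl⟩
    · rw [← integral_pow_sqPush, ← integral_pow_sqPush, h]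
    · rw [hμ.integral_odd_pow ⟨k, rfl⟩, hν.integral_odd_pow ⟨k, rfl⟩]

theorem isProbabilityMeasure_sqPush (μ : Measure ℝ) [IsProbabilityMeasure μ] :
    IsProbabilityMeasure (sqPush μ) :=
  Measure.isProbabilityMeasure_map (by fun_prop)

/-- The symmetrisation of a measure. -/
noncomputable def symmetrize (m : Measure ℝ) : Measure ℝ :=
  (2⁻¹ : ENNReal) • (m + m.map (fun x : ℝ => -x))

theorem isProbabilityMeasure_symmetrize (m : Measure ℝ) [IsProbabilityMeasure m] :
    IsProbabilityMeasure (symmetrize m) := by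
  have : IsProbabilityMeasure (m.map (fun x : ℝ => -x)) :=
    Measure.isProbabilityMeasure_map (by fun_prop)
  constructor
  rw [symmetrize, Measure.smul_apply, Measure.add_apply, measure_univ, measure_univ, smul_eq_mul,
    one_add_one_eq_two]
  exact ENNReal.inv_mul_cancel (by simp) (by simp)

theorem isSymmetricMeasure_symmetrize (m : Measure ℝ) : IsSymmetricMeasure (symmetrize m) := by
  unfold IsSymmetricMeasure symmetrize
  rw [Measure.map_smul, Measure.map_add _ _ (by fun_prop), Measure.map_map (by fun_prop)
    (by fun_prop)]
  have : (fun x : ℝ => -x) ∘ (fun x : ℝ => -x) = id := by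
    funext x
    simp
  rw [this, Measure.map_id, add_comm]

theorem ae_symmetrize {m : Measure ℝ} {r : ℝ} (h : ∀ᵐ t ∂m, |t| ≤ r) :
    ∀ᵐ t ∂(symmetrize m), |t| ≤ r := by
  apply Measure.ae_smul_measure
  rw [ae_add_measure_iff]
  refine ⟨h, ?_⟩
  rw [ae_map_iff (by fun_prop) (measurableSet_le (by fun_prop) (by fun_prop))]
  simpa using h

theorem integrable_pow_of_ae_le {m : Measure ℝ} [IsFiniteMeasure m] {r : ℝ}
    (h : ∀ᵐ t ∂m, |t| ≤ r) (n : ℕ) : Integrable (fun t : ℝ => t ^ n) m := by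
  refine Integrable.of_bound (by fun_prop) (r ^ n) ?_
  filter_upwards [h] with t ht
  rw [norm_pow, Real.norm_eq_abs]
  gcongr

theorem integral_pow_even_symmetrize {m : Measure ℝ} [IsFiniteMeasure m] {r : ℝ}
    (h : ∀ᵐ t ∂m, |t| ≤ r) (n : ℕ) :
    ∫ t, t ^ (2 * n) ∂(symmetrize m) = ∫ t, t ^ (2 * n) ∂m := by
  have hi := integrable_pow_of_ae_le h (2 * n)
  have hi' : Integrable (fun t : ℝ => t ^ (2 * n)) (m.map (fun x : ℝ => -x)) := by
    rw [integrable_map_measure (by fun_prop) (by fun_prop)]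
    simpa [Function.comp_def, (even_two_mul n).neg_pow] using hi
  rw [symmetrize, integral_smul_measure, integral_add_measure hi hi',
    integral_map (by fun_prop) (by fun_prop)]
  simp [(even_two_mul n).neg_pow]
  ring

end Measures

/-! ### Null elements of a state. -/

section State

variable {A : Type*} [Ring A] [StarRing A] [Algebra ℂ A] [StarModule ℂ A]

theorem eq_zero_of_forall_nonneg_add_mul {a s : ℝ} (h : ∀ r : ℝ, 0 ≤ a + r * s) : s = 0 := by
  by_contra hs
  have := h (-(a + 1) / s)
  rw [div_mul_cancel₀ _ hs] at this
  linarith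

/-- Positivity at `star w + c • d` has no quadratic term in `c`, since `d` is null. A real affine
function of `c ∈ ℂ` that stays nonnegative is constant, so testing real and imaginary `c` kills the
coefficient `φ (w * d)`. -/
theorem IsStarState.apply_mul_eq_zero {φ : A →ₗ[ℂ] ℂ} (hφ : IsStarState φ) {d : A}
    (hd : φ (star d * d) = 0) (w : A) : φ (w * d) = 0 := by
  have expand : ∀ c : ℂ, φ (star (star w + c • d) * (star w + c • d))
      = φ (w * star w) + c * φ (w * d) + (starRingEnd ℂ c) * φ (star d * star w) := by
    intro c
    simp only [star_add, star_star, star_smul, add_mul, mul_add, smul_mul_assoc, mul_smul_comm,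
      map_add, map_smul, hd, smul_eq_mul]
    simp
    ring
  have hp := fun c : ℂ => hφ.pos (star w + c • d)
  simp only [expand] at hp
  have h0 := (hp 0).2
  have h1 := (hp 1).2
  have hi := (hp Complex.I).2
  have hr : (φ (w * d)).re + (φ (star d * star w)).re = 0 := by
    refine eq_zero_of_forall_nonneg_add_mul (a := (φ (w * star w)).re) fun r => ?_
    have := (hp (r : ℂ)).1
    simp at this
    linarith
  have hir : -(φ (w * d)).im + (φ (star d * star w)).im = 0 := by
    refine eq_zero_of_forall_nonneg_add_mul (a := (φ (w * star w)).re) fun r => ?_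
    have := (hp (r * Complex.I : ℂ)).1
    simp at this
    linarith
  simp at h0 h1 hi
  apply Complex.ext
  · simp only [Complex.zero_re]
    linarith
  · simp only [Complex.zero_im]
    linarith

/-- In a tracial state, elements that are null may be dropped from powers of a sum. -/
theorem IsStarState.apply_pow_add_null {φ : A →ₗ[ℂ] ℂ} (hφ : IsStarState φ)
    (htr : ∀ u v, φ (u * v) = φ (v * u)) {b d : A} (hd : φ (star d * d) = 0) (n : ℕ) :
    φ ((b + (d + star d)) ^ n) = φ (b ^ n) := by
  have hd' : φ (star (star d) * star d) = 0 := by rw [star_star, htr, hd]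
  -- The free left factor `w` absorbs the letters already treated. The trace property then rotates
  -- any word containing `d` or `star d` until that letter stands last.
  have key : ∀ n w, φ (w * (b + (d + star d)) ^ n) = φ (w * b ^ n) := by
    intro n
    induction n with
    | zero => simp
    | succ n ih =>
      intro w
      rw [pow_succ', ← mul_assoc, ih, pow_succ', mul_add, mul_add, add_mul, add_mul, map_add,
        map_add, mul_assoc w d, htr w, mul_assoc d, htr d, mul_assoc w (star d), htr w,
        mul_assoc (star d), htr (star d), hφ.apply_mul_eq_zero hd, hφ.apply_mul_eq_zero hd']
      simp [mul_assoc]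
  simpa using key n 1

end State

/-! ### From a rectangular space of ratio zero to free elements of a corner. -/

namespace RectProbSpace

variable {A : Type*} [Ring A] [StarRing A] [Algebra ℂ A] [StarModule ℂ A]

section General

variable {d : ℕ} {ρ : Fin d → ℝ} (S : RectProbSpace ρ A)

theorem φ_mul_p (k : Fin d) (x : A) : S.φ k (x * S.p k) = S.φ k x := by
  rw [← S.φ_corner k (x * S.p k), ← S.φ_corner k x]
  simp only [mul_assoc, S.p_idem]

theorem φ_p_mul (k : Fin d) (x : A) : S.φ k (S.p k * x) = S.φ k x := by
  rw [← S.φ_corner k (S.p k * x), ← S.φ_corner k x, ← mul_assoc (S.p k) (S.p k), S.p_idem]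

theorem φ_one (k : Fin d) : S.φ k 1 = 1 := by
  rw [← S.φ_mul_p, one_mul, S.φ_unit]

theorem φ_eq_zero_of_mul_p {k : Fin d} {x : A} (h : x * S.p k = 0) : S.φ k x = 0 := by
  rw [← S.φ_mul_p, h, map_zero]

theorem φ_eq_zero_of_p_mul {k : Fin d} {x : A} (h : S.p k * x = 0) : S.φ k x = 0 := by
  rw [← S.φ_p_mul, h, map_zero]

/-- The elements which commute with a projector. -/
def commutant (k : Fin d) : StarSubalgebra ℂ A := StarSubalgebra.centralizer ℂ {S.p k}

theorem commute_of_mem_commutant {k : Fin d} {x : A} (hx : x ∈ S.commutant k) :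
    S.p k * x = x * S.p k :=
  (StarSubalgebra.mem_centralizer_iff ℂ).1 hx _ (by simp) |>.1

theorem mem_commutant {k : Fin d} {x : A} (hx : S.p k * x = x * S.p k) : x ∈ S.commutant k := by
  rw [commutant, StarSubalgebra.mem_centralizer_iff]
  rintro g rfl
  rw [S.p_star]
  exact ⟨hx, hx⟩

/-- The state on a corner, as a functional on the commutant of the projector. -/
def cornerState (k : Fin d) : S.commutant k →ₗ[ℂ] ℂ :=
  S.φ k ∘ₗ (S.commutant k).subtype.toAlgHom.toLinearMap

theorem cornerState_apply (k : Fin d) (x : S.commutant k) : S.cornerState k x = S.φ k (x : A) :=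
  rfl

/-- Compression by `p k` is multiplicative on the commutant of `p k`. This transfers positivity and
traciality from the corner to the commutant, which, unlike the corner, is a unital subalgebra of
`A`. -/
theorem φ_mul_eq {k : Fin d} {x : A} (hx : x ∈ S.commutant k) (y : A) :
    S.φ k (x * y) = S.φ k (S.p k * x * S.p k * (S.p k * y * S.p k)) := by
  have h := S.commute_of_mem_commutant hx
  have : S.p k * x * S.p k * (S.p k * y * S.p k) = S.p k * (x * y) * S.p k := by
    rw [h, mul_assoc x, S.p_idem, mul_assoc x, ← mul_assoc (S.p k), ← mul_assoc (S.p k), S.p_idem,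
      mul_assoc (S.p k), ← mul_assoc x, ← h]
    simp only [mul_assoc]
  rw [this, S.φ_corner]

theorem corner_eq (k : Fin d) (x : A) :
    S.p k * x * S.p k = S.p k * (S.p k * x * S.p k) * S.p k := by
  simp only [mul_assoc, S.p_idem]
  rw [← mul_assoc (S.p k) (S.p k), S.p_idem]

theorem isStarState_cornerState (k : Fin d) : IsStarState (S.cornerState k) where
  map_one := S.φ_one k
  pos x := by
    have : S.cornerState k (star x * x)
        = S.φ k (star (S.p k * (x : A) * S.p k) * (S.p k * (x : A) * S.p k)) := by
      rw [cornerState_apply]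
      push_cast
      rw [StarMemClass.coe_star, S.φ_mul_eq (star_mem x.2)]
      simp [S.p_star, mul_assoc]
    rw [this]
    exact S.φ_pos k _ (S.corner_eq k _)

theorem cornerState_mul_comm (k : Fin d) (x y : S.commutant k) :
    S.cornerState k (x * y) = S.cornerState k (y * x) := by
  rw [cornerState_apply, cornerState_apply]
  push_cast
  rw [S.φ_mul_eq x.2, S.φ_mul_eq y.2]
  exact S.φ_tracial k _ _ (S.corner_eq k _) (S.corner_eq k _)

end General

variable {ρ : Fin 2 → ℝ} (S : RectProbSpace ρ A)

theorem condExpD_apply (x : A) : S.condExpD x = S.φ 0 x • S.p 0 + S.φ 1 x • S.p 1 := by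
  simp [condExpD, Fin.sum_univ_two]

theorem φ_zero_condExpD (x : A) : S.φ 0 (S.condExpD x) = S.φ 0 x := by
  rw [condExpD_apply, map_add, map_smul, map_smul, S.φ_unit,
    S.φ_eq_zero_of_p_mul (S.p_orth 0 1 (by decide))]
  simp

/-- Compress every letter by `p 0`: the conditional expectation of the result is `φ 0` of the letter
times `p 0`, so centring for the state becomes centring over `D`, and freeness over `D` applies. -/
theorem isFreeFamily_cornerState {B : Fin 2 → StarSubalgebra ℂ A} (hp : ∀ i, S.p 0 ∈ B i)
    (hF : IsFreeFamily S.condExpD B) :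
    IsFreeFamily (S.cornerState 0) fun i => (B i).comap (S.commutant 0).subtype := by
  intro l hne hc hl
  let l' : List (Fin 2 × A) := l.map fun q => (q.1, S.p 0 * (q.2 : A) * S.p 0)
  have h : S.condExpD (l'.map Prod.snd).prod = 0 := by
    refine hF l' (by simpa [l'] using hne) (by simpa [l', Function.comp_def] using hc) ?_
    intro q hq
    obtain ⟨r, hr, rfl⟩ := List.mem_map.1 hq
    obtain ⟨hB, h0⟩ := hl r hr
    refine ⟨mul_mem (mul_mem (hp _) hB) (hp _), ?_⟩
    have h10 : S.p 0 * S.p 1 = 0 := S.p_orth 0 1 (by decide)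
    rw [condExpD_apply, S.φ_corner, ← S.cornerState_apply, h0,
      S.φ_eq_zero_of_mul_p (k := 1) (by rw [mul_assoc, h10, mul_zero])]
    simp
  -- The extra factor `S.p 0` on each side makes the identity true for the empty word as well, where
  -- the induction starts.
  have hprod : ∀ l : List (Fin 2 × S.commutant 0),
      ((l.map fun q => (q.1, S.p 0 * (q.2 : A) * S.p 0)).map Prod.snd).prod * S.p 0
        = S.p 0 * ((l.map Prod.snd).prod : A) := by
    intro l
    induction l with
    | nil => simp
    | cons q l ih =>
      have hq := S.commute_of_mem_commutant q.2.2
      simp only [List.map_cons, List.prod_cons]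
      rw [mul_assoc _ _ (S.p 0), ih]
      push_cast
      rw [hq, mul_assoc, mul_assoc, ← mul_assoc (S.p 0) (S.p 0), S.p_idem,
        ← mul_assoc (S.p 0) (S.p 0), S.p_idem, ← mul_assoc, ← hq, mul_assoc]
  rw [cornerState_apply, ← S.φ_p_mul, ← hprod, S.φ_mul_p, ← S.φ_zero_condExpD, h, map_zero]

/-- The only place where ratio zero acts: the weight `ρ 0 = 0` removes one side of `φ_rect`. -/
theorem φ_one_mul_eq_zero (h0 : ρ 0 = 0) (h1 : ρ 1 = 1) {x y : A} (hx : x = S.p 0 * x * S.p 1)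
    (hy : y = S.p 1 * y * S.p 0) : S.φ 1 (y * x) = 0 := by
  have := S.φ_rect 0 1 x y hx hy
  rw [h0, h1] at this
  simpa using this.symm

section RatioZero

variable {a : Fin 2 → A} (ha : ∀ i, a i = S.p 0 * a i * S.p 1)

include ha

theorem p_zero_mul_corner (i : Fin 2) : S.p 0 * a i = a i := by
  rw [ha i, ← mul_assoc, ← mul_assoc, S.p_idem]

theorem corner_mul_p_zero (i : Fin 2) : a i * S.p 0 = 0 := by
  rw [ha i, mul_assoc, S.p_orth 1 0 (by decide), mul_zero]

theorem p_one_mul_corner (i : Fin 2) : S.p 1 * a i = 0 := by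
  rw [ha i, ← mul_assoc, ← mul_assoc, S.p_orth 1 0 (by decide), zero_mul, zero_mul]

theorem star_corner (i : Fin 2) : star (a i) = S.p 1 * star (a i) * S.p 0 := by
  conv_lhs => rw [ha i]
  simp [S.p_star, mul_assoc]

theorem star_corner_mul_p_zero (i : Fin 2) : star (a i) * S.p 0 = star (a i) := by
  rw [S.star_corner ha i, mul_assoc, S.p_idem]

theorem condExpD_corner (i : Fin 2) : S.condExpD (a i) = 0 := by
  rw [condExpD_apply, S.φ_eq_zero_of_mul_p (S.corner_mul_p_zero ha i),
    S.φ_eq_zero_of_p_mul (S.p_one_mul_corner ha i)]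
  simp

theorem condExpD_star_corner (i : Fin 2) : S.condExpD (star (a i)) = 0 := by
  rw [condExpD_apply, S.φ_eq_zero_of_p_mul (k := 0), S.φ_eq_zero_of_mul_p (k := 1)]
  · simp
  · rw [S.star_corner ha i, mul_assoc, S.p_orth 0 1 (by decide), mul_zero]
  · rw [S.star_corner ha i, ← mul_assoc, ← mul_assoc, S.p_orth 0 1 (by decide), zero_mul, zero_mul]

theorem mul_star_mem_commutant (i j : Fin 2) : a i * star (a j) ∈ S.commutant 0 := by
  apply S.mem_commutant
  rw [← mul_assoc, S.p_zero_mul_corner ha, mul_assoc, S.star_corner_mul_p_zero ha]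

variable (h0 : ρ 0 = 0) (h1 : ρ 1 = 1)
include h0 h1

theorem condExpD_star_mul_corner (i : Fin 2) : S.condExpD (star (a i) * a i) = 0 := by
  rw [condExpD_apply, S.φ_one_mul_eq_zero h0 h1 (ha i) (S.star_corner ha i),
    S.φ_eq_zero_of_mul_p (k := 0)]
  · simp
  · rw [mul_assoc, S.corner_mul_p_zero ha, mul_zero]

/-- When the ratio is zero, the mixed products `a i * star (a j)` are null. -/
theorem φ_mixed_null (hF : S.FreeOverD a) :
    S.φ 0 (star (a 0 * star (a 1)) * (a 0 * star (a 1))) = 0 := by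
  obtain ⟨B, haB, -, hF⟩ := hF
  -- The middle letter `star (a 0) * a 0` is centred only because the ratio is zero; the outer
  -- letters are off-diagonal, hence always centred.
  have := hF [(1, a 1), (0, star (a 0) * a 0), (1, star (a 1))] (by simp) (by simp) (by
    intro q hq
    simp only [List.mem_cons, List.not_mem_nil, or_false] at hq
    rcases hq with rfl | rfl | rfl
    · exact ⟨haB 1, S.condExpD_corner ha 1⟩
    · exact ⟨mul_mem (star_mem (haB 0)) (haB 0), S.condExpD_star_mul_corner ha h0 h1 0⟩
    · exact ⟨star_mem (haB 1), S.condExpD_star_corner ha 1⟩)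
  rw [← S.φ_zero_condExpD]
  simpa [mul_assoc] using congrArg (S.φ 0) this

/-- The expanded product differs from the sum of squares by `d + star d` with `d = a 0 * star (a
1)`, which is null for the tracial state of the corner. -/
theorem φ_pow_add_mul_star (hF : S.FreeOverD a) (n : ℕ) :
    S.φ 0 (((a 0 + a 1) * star (a 0 + a 1)) ^ n)
      = S.φ 0 ((a 0 * star (a 0) + a 1 * star (a 1)) ^ n) := by
  let b : Fin 2 → Fin 2 → S.commutant 0 := fun i j =>
    ⟨a i * star (a j), S.mul_star_mem_commutant ha i j⟩
  have hd : S.cornerState 0 (star (b 0 1) * b 0 1) = 0 := S.φ_mixed_null ha h0 h1 hF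
  have h := (S.isStarState_cornerState 0).apply_pow_add_null (S.cornerState_mul_comm 0)
    (b := b 0 0 + b 1 1) hd n
  rw [cornerState_apply, cornerState_apply] at h
  push_cast at h
  rw [StarMemClass.coe_star] at h
  rw [← h]
  congr 2
  simp only [b, star_add, star_mul, star_star]
  noncomm_ring

end RatioZero

end RectProbSpace

/-- The required `*`-probability space is the commutant of `p 0` with the corner state, and the free
elements are `a i * star (a i)`. -/
theorem IsRectFreeConvolution.isFreeConvolution {μ₁ μ₂ μ : Measure ℝ}
    (h : IsRectFreeConvolution 0 μ₁ μ₂ μ) :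
    IsFreeConvolution (sqPush μ₁) (sqPush μ₂) (sqPush μ) := by
  obtain ⟨hp, hc, -, A, _, _, _, _, S, a, ha, hF, hm₁, hm₂, hm⟩ := h
  obtain ⟨B, haB, hpB, hFB⟩ := id hF
  refine ⟨isProbabilityMeasure_sqPush μ, isCompactlySupported_sqPush.2 hc, S.commutant 0,
    inferInstance, inferInstance, inferInstance, inferInstance, S.cornerState 0,
    fun i => ⟨a i * star (a i), S.mul_star_mem_commutant ha i i⟩, S.isStarState_cornerState 0,
    fun i => Subtype.ext (by simp), ⟨_, fun i => ?_,
      S.isFreeFamily_cornerState (fun i => hpB i 0) hFB⟩, fun n => ?_, fun n => ?_, fun n => ?_⟩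
  · exact mul_mem (haB i) (star_mem (haB i))
  · rw [integral_pow_sqPush, ← hm₁]
    rfl
  · rw [integral_pow_sqPush, ← hm₂]
    rfl
  · rw [integral_pow_sqPush, ← hm, S.φ_pow_add_mul_star ha (by simp) (by simp) hF]
    rfl

/-! ### A matrix model of ratio zero. -/

namespace RatioZeroModel

variable {C : Type} [Ring C] [StarRing C] [Algebra ℂ C] [StarModule ℂ C]

variable (C) in
/-- The algebra of the model: a corner at `0` is `C`, and the last factor carries the second
state. -/
abbrev Alg : Type := Matrix (Fin 3) (Fin 3) C × ℂ

/-- The diagonal of the projectors. -/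
def diag : Fin 2 → Fin 3 → C := ![![1, 0, 0], ![0, 1, 1]]

/-- The projectors. -/
def proj (k : Fin 2) : Alg C := (Matrix.diagonal (diag k), ![0, 1] k)

/-- The functionals. -/
def functional (φ : C →ₗ[ℂ] ℂ) (k : Fin 2) : Alg C →ₗ[ℂ] ℂ :=
  ![φ ∘ₗ Matrix.entryLinearMap ℂ C 0 0 ∘ₗ LinearMap.fst ℂ _ _, LinearMap.snd ℂ _ _] k

theorem functional_zero (φ : C →ₗ[ℂ] ℂ) (x : Alg C) : functional φ 0 x = φ (x.1 0 0) := rfl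

theorem functional_one (φ : C →ₗ[ℂ] ℂ) (x : Alg C) : functional φ 1 x = x.2 := rfl

theorem fst_apply_of_eq {k l : Fin 2} {x : Alg C} (h : x = proj k * x * proj l) (i j : Fin 3) :
    x.1 i j = diag k i * x.1 i j * diag l j := by
  conv_lhs => rw [h]
  simp [proj]

theorem snd_of_eq {k l : Fin 2} {x : Alg C} (h : x = proj k * x * proj l) :
    x.2 = ![0, 1] k * x.2 * ![0, 1] l := by
  conv_lhs => rw [h]
  simp [proj]

/-- The rectangular probability space of ratio zero over a tracial `*`-probability space. -/
def rectProbSpace {φ : C →ₗ[ℂ] ℂ} (hφ : IsStarState φ) (htr : ∀ u v, φ (u * v) = φ (v * u)) :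
    RectProbSpace ![(0 : ℝ) / (1 + 0), 1 / (1 + 0)] (Alg C) where
  p := proj
  p_ne_zero k h := by
    fin_cases k
    · have h00 : (1 : C) = 0 := by
        simpa [proj, diag] using congrFun (congrFun (congrArg Prod.fst h) 0) 0
      have := hφ.map_one
      rw [h00, map_zero] at this
      exact zero_ne_one this
    · simpa [proj] using congrArg Prod.snd h
  p_star k := by
    fin_cases k <;> refine Prod.ext ?_ ?_ <;> 
      simp [proj, diag, Matrix.star_eq_conjTranspose, Fin.forall_fin_succ]
  p_idem k := by
    fin_cases k <;> refine Prod.ext ?_ ?_ <;> simp [proj, diag, Fin.forall_fin_succ]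
  p_orth k l hkl := by
    fin_cases k <;> fin_cases l <;> simp at hkl <;> refine Prod.ext ?_ ?_ <;>
      simp [proj, diag, funext_iff, Fin.forall_fin_succ]
  p_sum := by
    rw [Fin.sum_univ_two]
    refine Prod.ext ?_ ?_ <;> simp [proj, diag, funext_iff, Fin.forall_fin_succ]
  φ := functional φ
  φ_corner k x := by
    fin_cases k <;> simp [functional_zero, functional_one, proj, diag]
  φ_unit k := by
    fin_cases k <;> simp [functional_zero, functional_one, proj, diag, hφ.map_one]
  φ_pos k x h := by
    fin_cases k
    · have h1 := fst_apply_of_eq h 1 0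
      have h2 := fst_apply_of_eq h 2 0
      simp [diag] at h1 h2
      simpa [functional_zero, Matrix.mul_apply, Fin.sum_univ_three, h1, h2] using
        hφ.pos (x.1 0 0)
    · simp [functional_one, ← Complex.normSq_eq_conj_mul_self, Complex.normSq_nonneg]
  φ_tracial k x y hx hy := by
    fin_cases k
    · have h1 := fst_apply_of_eq hx 1 0
      have h2 := fst_apply_of_eq hx 2 0
      have h3 := fst_apply_of_eq hx 0 1
      have h4 := fst_apply_of_eq hx 0 2
      simp [diag] at h1 h2 h3 h4
      simpa [functional_zero, Matrix.mul_apply, Fin.sum_univ_three, h1, h2, h3, h4] using htr _ _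
    · simp [functional_one, mul_comm]
  -- The second state is the character given by the `ℂ` factor, where `proj 0` vanishes; hence it
  -- kills everything that passes through the corner at 0, as the weight `ρ 0 = 0` demands.
  φ_rect k l x y hx hy := by
    have h := snd_of_eq hx
    fin_cases k <;> fin_cases l
    · simp
    · simp at h
      simp [functional_one, h]
    · simp at h
      simp [functional_one, h]
    · simp [functional_one, mul_comm]

/-- The index of the row and column used by the `i`-th element. -/
def own : Fin 2 → Fin 3 := ![1, 2]

/-- The index of the row and column not used by the `i`-th element. -/
def other : Fin 2 → Fin 3 := ![2, 1]

/-- The elements of the model. -/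
def elt (x : Fin 2 → C) (i : Fin 2) : Alg C := (Matrix.single 0 (own i) (x i), 0)

/-- The `*`-subalgebra of the model which contains the `i`-th element. -/
def subalg (B : Fin 2 → StarSubalgebra ℂ C) (i : Fin 2) : StarSubalgebra ℂ (Alg C) where
  -- The index `other i` is decoupled and carries only the scalar `X.2`, which is the value of the
  -- second state. Centring over `D` therefore clears that row and column entirely, yet both
  -- projectors still belong to the subalgebra.
  carrier := {X | (∀ j k, X.1 j k ∈ B i) ∧ (∀ j, j ≠ other i → X.1 (other i) j = 0 ∧
    X.1 j (other i) = 0) ∧ X.1 (other i) (other i) = algebraMap ℂ C X.2}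
  mul_mem' := by
    rintro X Y ⟨h1, h2, h3⟩ ⟨h1', h2', h3'⟩
    refine ⟨fun j k => ?_, fun j hj => ⟨?_, ?_⟩, ?_⟩
    · rw [Prod.fst_mul, Matrix.mul_apply]
      exact sum_mem fun m _ => mul_mem (h1 _ _) (h1' _ _)
    · rw [Prod.fst_mul, Matrix.mul_apply]
      refine Finset.sum_eq_zero fun m _ => ?_
      by_cases hm : m = other i
      · rw [hm, (h2' j hj).1, mul_zero]
      · rw [(h2 m hm).1, zero_mul]
    · rw [Prod.fst_mul, Matrix.mul_apply]
      refine Finset.sum_eq_zero fun m _ => ?_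
      by_cases hm : m = other i
      · rw [hm, (h2 j hj).2, zero_mul]
      · rw [(h2' m hm).2, mul_zero]
    · rw [Prod.fst_mul, Matrix.mul_apply, Finset.sum_eq_single (other i), h3, h3', Prod.snd_mul,
        map_mul]
      · intro m _ hm
        rw [(h2 m hm).1, zero_mul]
      · simp
  add_mem' := by
    rintro X Y ⟨h1, h2, h3⟩ ⟨h1', h2', h3'⟩
    refine ⟨fun j k => add_mem (h1 j k) (h1' j k), fun j hj => ?_, ?_⟩
    · simp [h2 j hj, h2' j hj]
    · simp [h3, h3']
  algebraMap_mem' := by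
    intro r
    refine ⟨fun j k => ?_, fun j hj => ?_, ?_⟩
    · change algebraMap ℂ (Matrix (Fin 3) (Fin 3) C) r j k ∈ B i
      rw [Matrix.algebraMap_matrix_apply]
      split_ifs
      · exact (B i).algebraMap_mem r
      · exact zero_mem _
    · simp [Prod.algebraMap_apply, Matrix.algebraMap_matrix_apply, hj, hj.symm]
    · simp [Prod.algebraMap_apply, Matrix.algebraMap_matrix_apply]
  star_mem' := by
    rintro X ⟨h1, h2, h3⟩
    refine ⟨fun j k => star_mem (h1 k j), fun j hj => ?_, ?_⟩
    · simp [Matrix.star_apply, h2 j hj]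
    · simpa [Matrix.star_apply, h3] using (algebraMap_star_comm X.2).symm

theorem elt_mem_subalg {x : Fin 2 → C} {B : Fin 2 → StarSubalgebra ℂ C} (hx : ∀ i, x i ∈ B i)
    (i : Fin 2) : elt x i ∈ subalg B i := by
  refine ⟨fun j k => ?_, fun j hj => ?_, ?_⟩
  · change Matrix.single 0 (own i) (x i) j k ∈ B i
    rw [Matrix.single_apply]
    split_ifs
    · exact hx i
    · exact zero_mem _
  · fin_cases i <;> simp [elt, own, other]
  · fin_cases i <;> simp [elt, own, other]

theorem proj_mem_subalg (B : Fin 2 → StarSubalgebra ℂ C) (i k : Fin 2) :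
    proj k ∈ subalg B i := by
  refine ⟨fun j m => ?_, fun j hj => ?_, ?_⟩
  · change Matrix.diagonal (diag k) j m ∈ B i
    rw [Matrix.diagonal_apply]
    split_ifs
    · fin_cases k <;> fin_cases j <;> simp [diag]
    · exact zero_mem _
  · simp [proj, hj, hj.symm]
  · fin_cases i <;> fin_cases k <;> simp [proj, diag, other]

section Free

variable {φ : C →ₗ[ℂ] ℂ} (hφ : IsStarState φ) (htr : ∀ u v, φ (u * v) = φ (v * u))

theorem functional_eq_zero_of_condExpD {X : Alg C}
    (h : (rectProbSpace hφ htr).condExpD X = 0) : φ (X.1 0 0) = 0 ∧ X.2 = 0 := by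
  rw [RectProbSpace.condExpD_apply] at h
  have h0 := congrArg (functional φ 0) h
  have h1 := congrArg (functional φ 1) h
  simp [rectProbSpace, functional_zero, functional_one, proj, diag, hφ.map_one] at h0 h1
  exact ⟨h0, h1⟩

/-- Centred elements of the two subalgebras live on the index sets {0, 1} and {0, 2}, so consecutive
factors can be linked only through the index 0. The (0,0) entry of an alternating product is then
the product of the (0,0) entries, and freeness in `C` applies to it. -/
theorem isFreeFamily_subalg {B : Fin 2 → StarSubalgebra ℂ C} (hF : IsFreeFamily φ B) :
    IsFreeFamily (rectProbSpace hφ htr).condExpD (subalg B) := by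
  have main : ∀ (l : List (Fin 2 × Alg C)) (q : Fin 2 × Alg C),
      ((q :: l).map Prod.fst).IsChain (fun i j => i ≠ j) →
      (∀ r ∈ q :: l, r.2 ∈ subalg B r.1 ∧ r.2.2 = 0) →
      ((q :: l).map Prod.snd).prod.1 0 0 = ((q :: l).map fun r => r.2.1 0 0).prod ∧
      ((q :: l).map Prod.snd).prod.1 (other q.1) 0 = 0 := by
    intro l
    induction l with
    | nil =>
      intro q _ hl
      refine ⟨by simp, ?_⟩
      have := ((hl q (by simp)).1.2.1 0 (by generalize q.1 = i; fin_cases i <;> simp [other])).1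
      simpa using this
    | cons r l ih =>
      intro q hc hl
      rw [List.map_cons, List.isChain_cons] at hc
      obtain ⟨e0, e1⟩ := ih r hc.2 fun s hs => hl s (List.mem_cons_of_mem _ hs)
      have hqr : q.1 ≠ r.1 := hc.1 r.1 (by simp)
      obtain ⟨⟨-, h2, h3⟩, h4⟩ := hl q (by simp)
      rw [h4, map_zero] at h3
      have hrow : ∀ j, q.2.1 (other q.1) j = 0 := by
        intro j
        by_cases hj : j = other q.1
        · rw [hj, h3]
        · exact (h2 j hj).1
      have hcol : q.2.1 0 (other q.1) = 0 :=
        (h2 0 (by generalize q.1 = i; fin_cases i <;> simp [other])).2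
      set P := ((r :: l).map Prod.snd).prod with hP
      have hprod : ((q :: r :: l).map Prod.snd).prod = q.2 * P := by simp [hP]
      rw [hprod, Prod.fst_mul, Matrix.mul_apply, Matrix.mul_apply]
      refine ⟨?_, Finset.sum_eq_zero fun j _ => by rw [hrow, zero_mul]⟩
      rw [List.map_cons, List.prod_cons, ← e0, Finset.sum_eq_single 0]
      · intro j _ hj
        -- The two indices `other q.1` and `other r.1` exhaust {1, 2}: the first is killed by the
        -- row of the new factor, the second by the inductive statement on column 0.
        have : j = other q.1 ∨ j = other r.1 := by
          revert hqr hj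
          generalize q.1 = i
          generalize r.1 = k
          revert i j k
          decide
        rcases this with rfl | rfl
        · rw [hcol, zero_mul]
        · rw [e1, mul_zero]
      · simp
  intro l hne hc hl
  have hl' : ∀ r ∈ l, r.2 ∈ subalg B r.1 ∧ r.2.2 = 0 := fun r hr =>
    ⟨(hl r hr).1, (functional_eq_zero_of_condExpD hφ htr (hl r hr).2).2⟩
  obtain ⟨q, t, rfl⟩ := List.exists_cons_of_ne_nil hne
  obtain ⟨h0, -⟩ := main t q hc hl'
  have hsnd : ((q :: t).map Prod.snd).prod.2 = 0 := by
    simp [(hl' q (by simp)).2]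
  rw [RectProbSpace.condExpD_apply]
  have hz : φ (((q :: t).map Prod.snd).prod.1 0 0) = 0 := by
    rw [h0]
    have := hF ((q :: t).map fun r => (r.1, r.2.1 0 0)) (by simp)
      (by simpa [Function.comp_def] using hc) (by
        intro r hr
        obtain ⟨s, hs, rfl⟩ := List.mem_map.1 hr
        exact ⟨(hl s hs).1.1 0 0, (functional_eq_zero_of_condExpD hφ htr (hl s hs).2).1⟩)
    simpa only [List.map_map, Function.comp_def] using this
  have e0 : (rectProbSpace hφ htr).φ 0 ((q :: t).map Prod.snd).prod = 0 := hz
  have e1 : (rectProbSpace hφ htr).φ 1 ((q :: t).map Prod.snd).prod = 0 := hsnd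
  rw [e0, e1]
  simp

end Free

/-- Stated for the (0,0) entry, since for `n = 0` the power is the full identity and not the matrix
unit. -/
theorem corner_pow_apply (X : Alg C) (c : C) (hX : X = (Matrix.single 0 0 c, 0)) (n : ℕ) :
    (X ^ n).1 0 0 = c ^ n := by
  induction n with
  | zero => simp
  | succ n ih =>
    rw [pow_succ', pow_succ', Prod.fst_mul, ← ih, hX]
    simp

theorem elt_mul_star {x : Fin 2 → C} (hx : ∀ i, star (x i) = x i) (i : Fin 2) :
    elt x i * star (elt x i) = (Matrix.single 0 0 (x i ^ 2), 0) := by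
  refine Prod.ext ?_ (by simp [elt])
  simp [elt, Matrix.star_eq_conjTranspose, hx, sq]

theorem add_mul_star {x : Fin 2 → C} (hx : ∀ i, star (x i) = x i) :
    (elt x 0 + elt x 1) * star (elt x 0 + elt x 1)
      = (Matrix.single 0 0 (x 0 ^ 2 + x 1 ^ 2), 0) := by
  have h01 : elt x 0 * star (elt x 1) = 0 :=
    Prod.ext (by simp [elt, own, Matrix.star_eq_conjTranspose]) (by simp [elt])
  have h10 : elt x 1 * star (elt x 0) = 0 :=
    Prod.ext (by simp [elt, own, Matrix.star_eq_conjTranspose]) (by simp [elt])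
  rw [star_add, add_mul, mul_add, mul_add, h01, h10, elt_mul_star hx, elt_mul_star hx]
  simp [Matrix.single_add]

/-- A tracial `*`-probability space with free self-adjoint elements of distributions `μ₁`, `μ₂`
gives a rectangular free convolution of ratio zero. -/
theorem isRectFreeConvolution {φ : C →ₗ[ℂ] ℂ} (hφ : IsStarState φ)
    (htr : ∀ u v, φ (u * v) = φ (v * u)) {x : Fin 2 → C} (hx : ∀ i, star (x i) = x i)
    {B : Fin 2 → StarSubalgebra ℂ C} (hB : ∀ i, x i ∈ B i) (hF : IsFreeFamily φ B)
    {μ₁ μ₂ μ : Measure ℝ} (hp : IsProbabilityMeasure μ) (hc : IsCompactlySupported μ)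
    (hs : IsSymmetricMeasure μ)
    (h₁ : ∀ n : ℕ, φ (x 0 ^ n) = ((∫ t, t ^ n ∂μ₁ : ℝ) : ℂ))
    (h₂ : ∀ n : ℕ, φ (x 1 ^ n) = ((∫ t, t ^ n ∂μ₂ : ℝ) : ℂ))
    (h : ∀ n : ℕ, φ ((x 0 ^ 2 + x 1 ^ 2) ^ n) = ((∫ t, t ^ (2 * n) ∂μ : ℝ) : ℂ)) :
    IsRectFreeConvolution 0 μ₁ μ₂ μ := by
  refine ⟨hp, hc, hs, Alg C, inferInstance, inferInstance, inferInstance, inferInstance,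
    rectProbSpace hφ htr, elt x, fun i => ?_, ⟨subalg B, elt_mem_subalg hB,
      fun i k => proj_mem_subalg B i k, isFreeFamily_subalg hφ htr hF⟩, fun n => ?_, fun n => ?_,
    fun n => ?_⟩
  · refine Prod.ext ?_ (by simp [elt])
    ext j k
    fin_cases i <;> fin_cases j <;> fin_cases k <;>
      simp [elt, rectProbSpace, proj, diag, own]
  · change functional φ 0 _ = _
    rw [functional_zero, corner_pow_apply _ _ (elt_mul_star hx 0), ← pow_mul, h₁]
  · change functional φ 0 _ = _
    rw [functional_zero, corner_pow_apply _ _ (elt_mul_star hx 1), ← pow_mul, h₂]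
  · change functional φ 0 _ = _
    rw [functional_zero, corner_pow_apply _ _ (add_mul_star hx), h]

end RatioZeroModel

/-! ### The Hilbert space free product of two copies of a space. -/

theorem HilbertBasis.eq_of_inner_eq {ι E : Type*} [NormedAddCommGroup E] [InnerProductSpace ℂ E]
    (b : HilbertBasis ι ℂ E) {v w : E} (h : ∀ i, inner ℂ (b i) v = inner ℂ (b i) w) : v = w := by
  apply b.repr.injective
  ext i
  rw [b.repr_apply_apply, b.repr_apply_apply, h]

namespace FreeProduct

variable {S K : Type} [NormedAddCommGroup K] [InnerProductSpace ℂ K] [CompleteSpace K]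

variable (S K) in
/-- The free product of two copies of a Hilbert space `K`. A word is encoded by its first letter
(or the distinguished unit vector) in `K`, followed by a list of basis vectors from the
complement of the distinguished vector. -/
abbrev Space : Type := lp (fun _ : List S => K) 2

variable (S K) in
/-- The action of operators on the first letter. -/
noncomputable def amplify : (K →L[ℂ] K) →⋆ₐ[ℂ] (Space S K →L[ℂ] Space S K) where
  toFun T := lp.mapCLM 2 (fun _ => T) (norm_nonneg T) (fun _ => le_rfl)
  map_one' := by ext; simp
  map_mul' _ _ := by ext; simp
  map_zero' := by ext; simp
  map_add' _ _ := by ext; simp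
  commutes' r := by ext; simp [Algebra.algebraMap_eq_smul_one]
  map_star' T := by
    rw [ContinuousLinearMap.star_eq_adjoint, ContinuousLinearMap.star_eq_adjoint,
      ContinuousLinearMap.eq_adjoint_iff]
    intro f g
    rw [lp.inner_eq_tsum, lp.inner_eq_tsum]
    simp [ContinuousLinearMap.adjoint_inner_left]

theorem amplify_apply (T : K →L[ℂ] K) (f : Space S K) (L : List S) :
    amplify S K T f L = T (f L) := by
  simp [amplify]

variable (b : HilbertBasis (Option S) ℂ K)

open Classical in
/-- The vectors of the word basis. -/
noncomputable def wordVec (p : Option S × List S) : Space S K := lp.single 2 p.2 (b p.1)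

theorem inner_wordVec (p : Option S × List S) (f : Space S K) :
    inner ℂ (wordVec b p) f = inner ℂ (b p.1) (f p.2) := by
  classical
  rw [wordVec, lp.inner_single_left]

theorem orthonormal_wordVec : Orthonormal ℂ (wordVec b) := by
  classical
  rw [orthonormal_iff_ite]
  rintro ⟨o, L⟩ ⟨o', L'⟩
  rw [inner_wordVec, wordVec]
  by_cases h : L = L'
  · subst h
    rw [lp.single_apply_self, orthonormal_iff_ite.1 b.orthonormal]
    simp
  · rw [lp.single_apply_ne _ _ _ h]
    simp [h]

/-- The involution which exchanges the two ways of reading a word. -/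
def flipWord : Option S × List S → Option S × List S
  -- With two factors, a reduced word is given by its labels and the factor of its first letter.
  -- `(some s, L)` is the word `s :: L` starting in factor 0, `(none, s :: L)` is the same list of
  -- labels starting in factor 1, and `(none, [])` is the vacuum.
  | (some s, L) => (none, s :: L)
  | (none, s :: L) => (some s, L)
  | (none, []) => (none, [])

theorem flipWord_flipWord (p : Option S × List S) : flipWord (flipWord p) = p := by
  rcases p with ⟨_ | s, _ | ⟨t, L⟩⟩ <;> rfl

theorem flipWord_injective : Function.Injective (flipWord (S := S)) :=
  Function.LeftInverse.injective flipWord_flipWord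

theorem span_orthogonal_eq_bot {v : Option S × List S → Space S K}
    (h : ∀ p, wordVec b p ∈ Set.range v) : (Submodule.span ℂ (Set.range v))ᗮ = ⊥ := by
  rw [Submodule.eq_bot_iff]
  intro f hf
  ext L : 2
  refine b.eq_of_inner_eq fun o => ?_
  rw [← inner_wordVec b (o, L)]
  simpa using (Submodule.mem_orthogonal _ _).1 hf _ (Submodule.subset_span (h (o, L)))

/-- The word basis. -/
noncomputable def wordBasis : HilbertBasis (Option S × List S) ℂ (Space S K) :=
  HilbertBasis.mkOfOrthogonalEqBot (orthonormal_wordVec b)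
    (span_orthogonal_eq_bot b fun p => ⟨p, rfl⟩)

/-- The flipped word basis. -/
noncomputable def flipBasis : HilbertBasis (Option S × List S) ℂ (Space S K) :=
  HilbertBasis.mkOfOrthogonalEqBot ((orthonormal_wordVec b).comp _ flipWord_injective)
    (span_orthogonal_eq_bot b fun p => ⟨flipWord p, by simp [flipWord_flipWord]⟩)

/-- The unitary which exchanges the two ways of reading a word. -/
noncomputable def flipUnitary : Space S K ≃ₗᵢ[ℂ] Space S K :=
  (wordBasis b).repr.trans (flipBasis b).repr.symm

theorem flipUnitary_wordVec (p : Option S × List S) :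
    flipUnitary b (wordVec b p) = wordVec b (flipWord p) := by
  classical
  have h1 : wordVec b p = wordBasis b p := by simp [wordBasis]
  have h2 : wordVec b (flipWord p) = flipBasis b p := by simp [flipBasis]
  rw [h1, h2, flipUnitary, LinearIsometryEquiv.trans_apply, HilbertBasis.repr_self,
    HilbertBasis.repr_symm_single]

/-- The unitaries which put the letters of the `i`-th factor into the first place. -/
noncomputable def readUnitary : Fin 2 → (Space S K ≃ₗᵢ[ℂ] Space S K) :=
  ![LinearIsometryEquiv.refl ℂ _, flipUnitary b]

/-- The representation of operators on the `i`-th factor. -/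
noncomputable def rep (i : Fin 2) : (K →L[ℂ] K) →⋆ₐ[ℂ] (Space S K →L[ℂ] Space S K) :=
  ((readUnitary b i).conjStarAlgEquiv :
    (Space S K →L[ℂ] Space S K) →⋆ₐ[ℂ] (Space S K →L[ℂ] Space S K)).comp (amplify S K)

theorem rep_apply (i : Fin 2) (T : K →L[ℂ] K) (f : Space S K) :
    rep b i T f = readUnitary b i (amplify S K T ((readUnitary b i).symm f)) := rfl

/-- The vacuum vector. -/
noncomputable def vacuum : Space S K := wordVec b (none, [])

theorem readUnitary_vacuum (i : Fin 2) : readUnitary b i (vacuum b) = vacuum b := by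
  fin_cases i
  · rfl
  · exact flipUnitary_wordVec b _

theorem readUnitary_symm_vacuum (i : Fin 2) : (readUnitary b i).symm (vacuum b) = vacuum b := by
  rw [LinearIsometryEquiv.symm_apply_eq, readUnitary_vacuum]

theorem inner_vacuum (f : Space S K) : inner ℂ (vacuum b) f = inner ℂ (b none) (f []) :=
  inner_wordVec b _ f

theorem vacuum_apply_nil : (vacuum b) [] = b none := by
  simp [vacuum, wordVec]

/-- The vectors spanned by the words which start with the `i`-th factor. -/
def StartsWith (i : Fin 2) (f : Space S K) : Prop :=
  ∀ L, inner ℂ (b none) (((readUnitary b i).symm f) L) = 0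

theorem inner_vacuum_of_startsWith {i : Fin 2} {f : Space S K} (h : StartsWith b i f) :
    inner ℂ (vacuum b) f = 0 := by
  rw [← LinearIsometryEquiv.inner_map_map (readUnitary b i).symm, readUnitary_symm_vacuum,
    inner_vacuum, h]

theorem inner_symm_flipUnitary (p : Option S × List S) (f : Space S K) :
    inner ℂ (b p.1) (((flipUnitary b).symm f) p.2)
      = inner ℂ (b (flipWord p).1) (f (flipWord p).2) := by
  rw [← inner_wordVec, ← inner_wordVec, ← flipUnitary_wordVec,
    ← LinearIsometryEquiv.inner_map_map (flipUnitary b), LinearIsometryEquiv.apply_symm_apply]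

theorem eq_smul_of_inner_some {v : K} (h : ∀ s, inner ℂ (b (some s)) v = 0) :
    v = (inner ℂ (b none) v) • b none := by
  classical
  refine b.eq_of_inner_eq fun o => ?_
  rw [inner_smul_right, orthonormal_iff_ite.1 b.orthonormal]
  rcases o with _ | s
  · simp
  · simp [h]

theorem exists_eq_smul_vacuum (i : Fin 2) (L : List S) :
    ∃ c : ℂ, ((readUnitary b i).symm (vacuum b)) L = c • b none := by
  classical
  rw [readUnitary_symm_vacuum, vacuum, wordVec]
  by_cases h : L = []
  · subst h
    exact ⟨1, by simp⟩
  · exact ⟨0, by rw [lp.single_apply_ne _ _ _ h, zero_smul]⟩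

/-- A word that starts in factor `j` has no letter of factor `i` in front, so when read for `i` its
first place holds the distinguished vector. -/
theorem exists_eq_smul_of_startsWith {i j : Fin 2} (hij : i ≠ j) {f : Space S K}
    (hf : StartsWith b j f) (L : List S) :
    ∃ c : ℂ, ((readUnitary b i).symm f) L = c • b none := by
  refine ⟨_, eq_smul_of_inner_some b fun s => ?_⟩
  have hcases : (i = 0 ∧ j = 1) ∨ (i = 1 ∧ j = 0) := by
    clear hf
    revert i j
    decide
  rcases hcases with ⟨rfl, rfl⟩ | ⟨rfl, rfl⟩
  · exact (inner_symm_flipUnitary b (none, s :: L) f).symm.trans (hf (s :: L))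
  · exact (inner_symm_flipUnitary b (some s, L) f).trans (hf (s :: L))

/-- A centred operator sends the distinguished vector into its orthogonal complement, so it puts a
genuine letter of factor `i` in front of each word. -/
theorem startsWith_rep {i : Fin 2} {T : K →L[ℂ] K} (hT : inner ℂ (b none) (T (b none)) = 0)
    {f : Space S K} (hf : ∀ L, ∃ c : ℂ, ((readUnitary b i).symm f) L = c • b none) :
    StartsWith b i (rep b i T f) := by
  intro L
  obtain ⟨c, hc⟩ := hf L
  rw [rep_apply, LinearIsometryEquiv.symm_apply_apply, amplify_apply, hc, map_smul,
    inner_smul_right, hT, mul_zero]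

/-- The vector functional of a vector. -/
noncomputable def vectorState {H : Type*} [NormedAddCommGroup H] [InnerProductSpace ℂ H] (Ω : H) :
    (H →L[ℂ] H) →ₗ[ℂ] ℂ where
  toFun T := inner ℂ Ω (T Ω)
  map_add' _ _ := by simp
  map_smul' _ _ := by simp

theorem vectorState_apply {H : Type*} [NormedAddCommGroup H] [InnerProductSpace ℂ H] (Ω : H)
    (T : H →L[ℂ] H) : vectorState Ω T = inner ℂ Ω (T Ω) := rfl

theorem isStarState_vectorState {H : Type*} [NormedAddCommGroup H] [InnerProductSpace ℂ H]
    [CompleteSpace H] {Ω : H} (hΩ : ‖Ω‖ = 1) : IsStarState (vectorState Ω) where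
  map_one := by simp [vectorState_apply, inner_self_eq_norm_sq_to_K, hΩ]
  pos x := by
    rw [vectorState_apply, mul_apply_eq_comp, ContinuousLinearMap.star_eq_adjoint,
      ContinuousLinearMap.adjoint_inner_right, inner_self_eq_norm_sq_to_K]
    have h : ((‖x Ω‖ : ℝ) : ℂ) ^ 2 = ((‖x Ω‖ ^ 2 : ℝ) : ℂ) := by push_cast; rfl
    change 0 ≤ (((‖x Ω‖ : ℝ) : ℂ) ^ 2).re ∧ (((‖x Ω‖ : ℝ) : ℂ) ^ 2).im = 0
    rw [h]
    exact ⟨by rw [Complex.ofReal_re]; positivity, Complex.ofReal_im _⟩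

theorem norm_vacuum : ‖vacuum b‖ = 1 := (orthonormal_wordVec b).1 _

theorem vectorState_rep (i : Fin 2) (T : K →L[ℂ] K) :
    vectorState (vacuum b) (rep b i T) = inner ℂ (b none) (T (b none)) := by
  rw [vectorState_apply, rep_apply, ← LinearIsometryEquiv.inner_map_map (readUnitary b i).symm,
    LinearIsometryEquiv.symm_apply_apply, readUnitary_symm_vacuum, inner_vacuum, amplify_apply,
    vacuum_apply_nil]

/-- The two representations are free with respect to the vacuum state. -/
theorem isFreeFamily_of_le_range {B : Fin 2 → StarSubalgebra ℂ (Space S K →L[ℂ] Space S K)}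
    (hB : ∀ i, B i ≤ (rep b i).range) : IsFreeFamily (vectorState (vacuum b)) B := by
  -- Applied to the vacuum from right to left, each centred factor adds a new first letter of its
  -- own kind, so the result stays orthogonal to the vacuum.
  have main : ∀ (l : List (Fin 2 × (Space S K →L[ℂ] Space S K))) q,
      ((q :: l).map Prod.fst).IsChain (fun i j => i ≠ j) →
      (∀ r ∈ q :: l, r.2 ∈ B r.1 ∧ vectorState (vacuum b) r.2 = 0) →
      StartsWith b q.1 (((q :: l).map Prod.snd).prod (vacuum b)) := by
    intro l
    induction l with
    | nil =>
      intro q _ hl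
      obtain ⟨h1, h2⟩ := hl q (by simp)
      obtain ⟨T, hT⟩ := hB _ h1
      replace hT : rep b q.1 T = q.2 := hT
      rw [← hT, vectorState_rep] at h2
      simp only [List.map_cons, List.map_nil, List.prod_cons, List.prod_nil, mul_one]
      rw [← hT]
      exact startsWith_rep b h2 (exists_eq_smul_vacuum b _)
    | cons r l ih =>
      intro q hc hl
      rw [List.map_cons, List.isChain_cons] at hc
      have := ih r hc.2 fun s hs => hl s (List.mem_cons_of_mem _ hs)
      obtain ⟨h1, h2⟩ := hl q (by simp)
      obtain ⟨T, hT⟩ := hB _ h1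
      replace hT : rep b q.1 T = q.2 := hT
      rw [← hT, vectorState_rep] at h2
      rw [List.map_cons, List.prod_cons, mul_apply_eq_comp, ← hT]
      exact startsWith_rep b h2 (exists_eq_smul_of_startsWith b (hc.1 r.1 (by simp)) this)
  intro l hne hc hl
  obtain ⟨q, t, rfl⟩ := List.exists_cons_of_ne_nil hne
  exact inner_vacuum_of_startsWith b (main t q hc hl)

end FreeProduct

/-! ### Operators with prescribed laws, and laws of operators. -/

theorem exists_hilbertBasis_option {K : Type} [NormedAddCommGroup K] [InnerProductSpace ℂ K]
    [CompleteSpace K] {ξ : K} (hξ : ‖ξ‖ = 1) :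
    ∃ (S : Type) (b : HilbertBasis (Option S) ℂ K), b none = ξ := by
  classical
  have h1 : Orthonormal ℂ ((↑) : ({ξ} : Set K) → K) := by
    refine ⟨fun x => ?_, fun x y hxy => absurd (Subsingleton.elim x y) hxy⟩
    rw [Set.mem_singleton_iff.1 x.2, hξ]
  obtain ⟨w, b, hw, hb⟩ := h1.exists_hilbertBasis_extension
  let x₀ : w := ⟨ξ, hw rfl⟩
  let e : Option {x : w // x ≠ x₀} ≃ w := Equiv.optionSubtypeNe x₀
  refine ⟨{x : w // x ≠ x₀}, HilbertBasis.mk (b.orthonormal.comp e e.injective) ?_, ?_⟩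
  · rw [e.surjective.range_comp, b.dense_span]
  · rw [HilbertBasis.coe_mk, Function.comp_apply, hb]
    simp [e, x₀]

section Multiplication

variable {X : Type} [MeasurableSpace X] {ν : Measure X}

/-- Multiplication by a bounded real function on `L²`. -/
theorem exists_multiplication_operator {g : X → ℝ} (hg : Measurable g) {r : ℝ}
    (hr : ∀ᵐ x ∂ν, |g x| ≤ r) :
    ∃ T : Lp ℂ 2 ν →L[ℂ] Lp ℂ 2 ν, star T = T ∧
      ∀ f : Lp ℂ 2 ν, T f =ᵐ[ν] fun x => (g x : ℂ) * f x := by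
  have hmem : MemLp (fun x => (g x : ℂ)) ⊤ ν :=
    memLp_top_of_bound (by fun_prop) r (by simpa using hr)
  let T : Lp ℂ 2 ν →L[ℂ] Lp ℂ 2 ν := (ContinuousLinearMap.mul ℂ ℂ).holderL ν ⊤ 2 2 hmem.toLp
  have hT : ∀ f : Lp ℂ 2 ν, T f =ᵐ[ν] fun x => (g x : ℂ) * f x := by
    intro f
    have h := (ContinuousLinearMap.mul ℂ ℂ).coeFn_holder (r := 2) hmem.toLp f
    filter_upwards [h, hmem.coeFn_toLp] with x h1 h2
    refine Eq.trans h1 ?_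
    rw [h2]
    rfl
  refine ⟨T, ?_, hT⟩
  rw [ContinuousLinearMap.star_eq_adjoint]
  symm
  rw [ContinuousLinearMap.eq_adjoint_iff]
  intro f h
  rw [L2.inner_def, L2.inner_def]
  refine integral_congr_ae ?_
  filter_upwards [hT f, hT h] with x h1 h2
  rw [h1, h2]
  simp [RCLike.inner_apply]
  ring

theorem inner_one_pow_multiplication [IsProbabilityMeasure ν] {g : X → ℝ}
    {T : Lp ℂ 2 ν →L[ℂ] Lp ℂ 2 ν} (hT : ∀ f : Lp ℂ 2 ν, T f =ᵐ[ν] fun x => (g x : ℂ) * f x)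
    {e : Lp ℂ 2 ν} (he : e =ᵐ[ν] fun _ => 1) (n : ℕ) :
    inner ℂ e ((T ^ n) e) = ((∫ x, g x ^ n ∂ν : ℝ) : ℂ) := by
  have h : (T ^ n) e =ᵐ[ν] fun x => (g x : ℂ) ^ n := by
    induction n with
    | zero => simpa using he
    | succ n ih =>
      rw [pow_succ', mul_apply_eq_comp]
      filter_upwards [hT ((T ^ n) e), ih] with x h1 h2
      rw [h1, h2, pow_succ']
  rw [L2.inner_def, ← integral_complex_ofReal]
  refine integral_congr_ae ?_
  filter_upwards [he, h] with x h1 h2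
  rw [h1, h2]
  simp

end Multiplication

/-- The distribution of a self-adjoint operator with respect to a vector state. -/
theorem exists_spectral_distribution {H : Type} [NormedAddCommGroup H] [InnerProductSpace ℂ H]
    [CompleteSpace H] {Ω : H} (hΩ : ‖Ω‖ = 1) {T : H →L[ℂ] H} (hT : IsSelfAdjoint T) :
    ∃ m : Measure ℝ, IsProbabilityMeasure m ∧ IsCompactlySupported m ∧
      ∀ n : ℕ, FreeProduct.vectorState Ω (T ^ n) = ((∫ t, t ^ n ∂m : ℝ) : ℂ) := by
  let X := spectrum ℝ T
  let Λ₀ : CompactlySupportedContinuousMap X ℝ →ₗ[ℝ] ℝ :=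
    { toFun := fun f => (FreeProduct.vectorState Ω (cfcHom hT (f : C(X, ℝ)))).re
      map_add' := fun f g => by
        have : ((f + g : CompactlySupportedContinuousMap X ℝ) : C(X, ℝ)) = (f : C(X, ℝ)) + g := rfl
        rw [this, map_add, map_add, Complex.add_re]
      map_smul' := fun c f => by
        have : ((c • f : CompactlySupportedContinuousMap X ℝ) : C(X, ℝ)) = c • (f : C(X, ℝ)) := rfl
        rw [this, map_smul, ← Complex.coe_smul, map_smul]
        simp }
  have hΛ : ∀ f : CompactlySupportedContinuousMap X ℝ, 0 ≤ f → 0 ≤ Λ₀ f := by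
    intro f hf
    -- Positivity of the functional comes from writing `f` as the square of its root, which the
    -- functional calculus sends to an element of the form `star u * u`.
    let h : C(X, ℝ) := ⟨fun x => Real.sqrt (f x), by fun_prop⟩
    have hh : (f : C(X, ℝ)) = star h * h := by
      ext x
      simp [h, Real.mul_self_sqrt (hf x)]
    change 0 ≤ (FreeProduct.vectorState Ω (cfcHom hT (f : C(X, ℝ)))).re
    rw [hh, map_mul, map_star]
    exact ((FreeProduct.isStarState_vectorState hΩ).pos _).1
  let Λ : CompactlySupportedContinuousMap X ℝ →ₚ[ℝ] ℝ := PositiveLinearMap.mk₀ Λ₀ hΛ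
  let m := RealRMK.rieszMeasure Λ
  have key : ∀ n : ℕ, ∫ x : X, (x : ℝ) ^ n ∂m = (FreeProduct.vectorState Ω (T ^ n)).re := by
    intro n
    let f : C(X, ℝ) := (ContinuousMap.restrict X (.id ℝ)) ^ n
    have h := RealRMK.integral_rieszMeasure Λ (CompactlySupportedContinuousMap.continuousMapEquiv f)
    have h2 : Λ (CompactlySupportedContinuousMap.continuousMapEquiv f)
        = (FreeProduct.vectorState Ω (cfcHom hT f)).re := rfl
    have hf : cfcHom hT f = T ^ n := by
      rw [map_pow]
      exact congrArg (· ^ n) (cfcHom_id hT)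
    rw [h2, hf] at h
    rw [← h]
    rfl
  have hfin : IsFiniteMeasure m := inferInstance
  have hprob : IsProbabilityMeasure m := by
    have h0 := key 0
    rw [pow_zero, (FreeProduct.isStarState_vectorState hΩ).map_one] at h0
    simp [Measure.real] at h0
    constructor
    rw [← ENNReal.ofReal_toReal (measure_ne_top m _), h0, ENNReal.ofReal_one]
  refine ⟨m.map Subtype.val, Measure.isProbabilityMeasure_map (by fun_prop), ?_, fun n => ?_⟩
  · have hcomp : IsCompact X := spectrum.isCompact T
    refine ⟨X, hcomp, ?_⟩
    rw [Measure.map_apply (by fun_prop) hcomp.isClosed.measurableSet.compl]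
    simp
  · rw [integral_map (by fun_prop) (by fun_prop), key]
    apply Complex.ext
    · simp
    · rw [Complex.ofReal_im, FreeProduct.vectorState_apply, ← Complex.conj_eq_iff_im]
      rw [inner_conj_symm]
      have := (ContinuousLinearMap.isSelfAdjoint_iff_isSymmetric.1 (hT.pow n)) Ω Ω
      exact this

/-- The restriction of a free family to a `*`-subalgebra is free. -/
theorem IsFreeFamily.comap_subtype {ι A : Type*} [Ring A] [StarRing A] [Algebra ℂ A]
    [StarModule ℂ A] {φ : A →ₗ[ℂ] ℂ} {B : ι → StarSubalgebra ℂ A} (hF : IsFreeFamily φ B)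
    (C : StarSubalgebra ℂ A) :
    IsFreeFamily (φ ∘ₗ C.subtype.toAlgHom.toLinearMap) fun i => (B i).comap C.subtype := by
  intro l hne hc hl
  have := hF (l.map fun q => (q.1, (q.2 : A))) (by simpa using hne)
    (by simpa [Function.comp_def] using hc) (by
      intro q hq
      obtain ⟨r, hr, rfl⟩ := List.mem_map.1 hq
      exact hl r hr)
  have e : (C.subtype (l.map Prod.snd).prod : A)
      = ((l.map fun q => (q.1, (q.2 : A))).map Prod.snd).prod := by
    rw [map_list_prod]
    simp [Function.comp_def]
  rw [← e] at this
  exact this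

/-- Two compactly supported distributions are realised by operators on a Hilbert space. -/
theorem exists_operators (μ : Fin 2 → Measure ℝ) [∀ i, IsProbabilityMeasure (μ i)]
    (hc : ∀ i, IsCompactlySupported (μ i)) :
    ∃ (K : Type) (_ : NormedAddCommGroup K) (_ : InnerProductSpace ℂ K) (_ : CompleteSpace K)
      (ξ : K) (T : Fin 2 → K →L[ℂ] K), ‖ξ‖ = 1 ∧ (∀ i, star (T i) = T i) ∧
      ∀ i n, inner ℂ ξ ((T i ^ n) ξ) = ((∫ t, t ^ n ∂(μ i) : ℝ) : ℂ) := by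
  -- The product measure lets one space `K` and one unit vector serve both laws, so the free product
  -- can use two copies of the same pointed space. The independence of the coordinates plays no
  -- role.
  let ν : Measure (Fin 2 → ℝ) := Measure.pi μ
  have hmp : ∀ i, MeasurePreserving (fun x : Fin 2 → ℝ => x i) ν (μ i) :=
    fun i => measurePreserving_eval μ i
  have h : ∀ i, ∃ T : Lp ℂ 2 ν →L[ℂ] Lp ℂ 2 ν, star T = T ∧
      ∀ f : Lp ℂ 2 ν, T f =ᵐ[ν] fun x => ((x i : ℝ) : ℂ) * f x := by
    intro i
    obtain ⟨r, hr⟩ := isCompactlySupported_iff.1 (hc i)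
    exact exists_multiplication_operator (measurable_pi_apply i) (r := r)
      ((hmp i).quasiMeasurePreserving.ae hr)
  choose T hTs hT using h
  have hone : MemLp (fun _ : Fin 2 → ℝ => (1 : ℂ)) 2 ν := memLp_const 1
  have hmom : ∀ i n, inner ℂ hone.toLp ((T i ^ n) hone.toLp)
      = ((∫ t, t ^ n ∂(μ i) : ℝ) : ℂ) := by
    intro i n
    rw [inner_one_pow_multiplication (hT i) hone.coeFn_toLp, ← (hmp i).map_eq,
      integral_map (hmp i).measurable.aemeasurable (by fun_prop)]
  refine ⟨Lp ℂ 2 ν, inferInstance, inferInstance, inferInstance, hone.toLp, T, ?_, hTs, hmom⟩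
  have := hmom 0 0
  simp only [pow_zero, integral_const, probReal_univ, smul_eq_mul, mul_one] at this
  rw [one_apply_eq_self, inner_self_eq_norm_sq_to_K] at this
  have h2 : ‖hone.toLp‖ ^ 2 = 1 := Complex.ofReal_injective (by simpa using this)
  exact (pow_eq_one_iff_of_nonneg (norm_nonneg _) two_ne_zero).1 h2

/-- The distribution of a sum of squares is the image under squaring of a symmetric measure. -/
theorem exists_symmetric_distribution {H : Type} [NormedAddCommGroup H] [InnerProductSpace ℂ H]
    [CompleteSpace H] {Ω : H} (hΩ : ‖Ω‖ = 1) {x y : H →L[ℂ] H} (hx : IsSelfAdjoint x)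
    (hy : IsSelfAdjoint y) :
    ∃ μ : Measure ℝ, IsProbabilityMeasure μ ∧ IsCompactlySupported μ ∧ IsSymmetricMeasure μ ∧
      ∀ n : ℕ, FreeProduct.vectorState Ω ((x ^ 2 + y ^ 2) ^ n)
        = ((∫ t, t ^ (2 * n) ∂μ : ℝ) : ℂ) := by
  have h0 : 0 ≤ x ^ 2 + y ^ 2 := add_nonneg hx.sq_nonneg hy.sq_nonneg
  -- Taking the law of the square root makes its even moments the required ones; symmetrising does
  -- not change them.
  obtain ⟨m, hm, hmc, hmom⟩ := exists_spectral_distribution hΩ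
    (T := CFC.sqrt (x ^ 2 + y ^ 2)) (CFC.sqrt_nonneg _).isSelfAdjoint
  obtain ⟨r, hr⟩ := isCompactlySupported_iff.1 hmc
  refine ⟨symmetrize m, isProbabilityMeasure_symmetrize m,
    isCompactlySupported_iff.2 ⟨r, ae_symmetrize hr⟩, isSymmetricMeasure_symmetrize m, fun n => ?_⟩
  rw [integral_pow_even_symmetrize hr, ← hmom, pow_mul, CFC.sq_sqrt _ h0]

/-! ### Existence, uniqueness and the characterisation. -/

/-- The rectangular free convolution with ratio zero exists. -/
theorem exists_isRectFreeConvolution (μ₁ μ₂ : Measure ℝ) [IsProbabilityMeasure μ₁]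
    [IsProbabilityMeasure μ₂] (hc₁ : IsCompactlySupported μ₁) (hc₂ : IsCompactlySupported μ₂) :
    ∃ μ, IsRectFreeConvolution 0 μ₁ μ₂ μ := by
  have hprob : ∀ i, IsProbabilityMeasure (![μ₁, μ₂] i) := by
    intro i
    fin_cases i <;> assumption
  obtain ⟨K, _, _, _, ξ, T, hξ, hTs, hT⟩ := exists_operators ![μ₁, μ₂] (by
    intro i
    fin_cases i <;> assumption)
  obtain ⟨S, b, rfl⟩ := exists_hilbertBasis_option hξ
  let H := FreeProduct.Space S K
  let φ : (H →L[ℂ] H) →ₗ[ℂ] ℂ := FreeProduct.vectorState (FreeProduct.vacuum b)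
  have hφ : IsStarState φ := FreeProduct.isStarState_vectorState (FreeProduct.norm_vacuum b)
  let X : Fin 2 → H →L[ℂ] H := fun i => FreeProduct.rep b i (T i)
  have hX : ∀ i, star (X i) = X i := fun i => by rw [← map_star, hTs]
  have hXmom : ∀ i n, φ (X i ^ n) = ((∫ t, t ^ n ∂(![μ₁, μ₂] i) : ℝ) : ℂ) := fun i n => by
    rw [← hT, ← map_pow]
    exact FreeProduct.vectorState_rep b i _
  let B : Fin 2 → StarSubalgebra ℂ (H →L[ℂ] H) := fun i => StarAlgebra.adjoin ℂ {X i}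
  have hXB : ∀ i, X i ∈ B i := fun i => StarAlgebra.self_mem_adjoin_singleton ℂ _
  have hF : IsFreeFamily φ B := FreeProduct.isFreeFamily_of_le_range b fun i =>
    StarAlgebra.adjoin_le (by
      rintro _ rfl
      exact ⟨T i, rfl⟩)
  -- Each `B i` is generated by one self-adjoint element, hence commutative, so the state is tracial
  -- on it.
  have hcomm : ∀ i, ∀ u ∈ B i, ∀ v ∈ B i, φ (u * v) = φ (v * u) := by
    intro i u hu v hv
    rw [mem_adjoin_singleton_iff_of_star_eq (hX i)] at hu hv
    exact congrArg φ (congrArg Subtype.val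
      (mul_comm (⟨u, hu⟩ : Algebra.adjoin ℂ {X i}) ⟨v, hv⟩))
  -- The matrix model needs a trace. Traciality of the vacuum state has been reduced to the algebra
  -- generated by the `X i`, so everything is restricted to it.
  let C : StarSubalgebra ℂ (H →L[ℂ] H) := StarAlgebra.adjoin ℂ (Set.range X)
  have hXC : ∀ i, X i ∈ C := fun i => StarAlgebra.subset_adjoin ℂ _ (Set.mem_range_self i)
  have hCmem : ∀ u : C, (u : H →L[ℂ] H) ∈ Algebra.adjoin ℂ (Set.range X) := by
    intro u
    have hu := u.2
    rw [← StarSubalgebra.mem_toSubalgebra, StarAlgebra.adjoin_toSubalgebra] at hu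
    have hs : star (Set.range X) = Set.range X := by
      ext y
      rw [Set.mem_star]
      constructor
      · rintro ⟨i, hi⟩
        exact ⟨i, by rw [← hX, hi, star_star]⟩
      · rintro ⟨i, rfl⟩
        exact ⟨i, (hX i).symm⟩
    rwa [hs, Set.union_self] at hu
  let φC : C →ₗ[ℂ] ℂ := φ ∘ₗ C.subtype.toAlgHom.toLinearMap
  have hφC : IsStarState φC := ⟨hφ.map_one, fun u => hφ.pos u⟩
  have htr : ∀ u v, φC (u * v) = φC (v * u) := fun u v =>
    hF.apply_mul_comm hφ.map_one hcomm (s := Set.range X)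
      (by rintro _ ⟨i, rfl⟩; exact ⟨i, hXB i⟩) (hCmem u) (hCmem v)
  obtain ⟨μ, hp, hc, hs, hmom⟩ :=
    exists_symmetric_distribution (FreeProduct.norm_vacuum b) (hX 0) (hX 1)
  exact ⟨μ, RatioZeroModel.isRectFreeConvolution hφC htr
    (x := fun i => ⟨X i, hXC i⟩) (fun i => Subtype.ext (hX i))
    (B := fun i => (B i).comap C.subtype) (fun i => hXB i) (hF.comap_subtype C)
    hp hc hs (hXmom 0) (hXmom 1) hmom⟩

/-- The free additive convolution is unique. -/
theorem IsFreeConvolution.unique {ν₁ ν₂ ν ν' : Measure ℝ} (h : IsFreeConvolution ν₁ ν₂ ν)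
    (h' : IsFreeConvolution ν₁ ν₂ ν') : ν = ν' := by
  obtain ⟨hp, hc, A, _, _, _, _, φ, x, hφ, hx, ⟨B, hB, hF⟩, h1, h2, h3⟩ := h
  obtain ⟨hp', hc', A', _, _, _, _, φ', x', hφ', hx', ⟨B', hB', hF'⟩, h1', h2', h3'⟩ := h'
  refine ext_of_moments hc hc' fun n => ?_
  have := moments_add_eq_of_free hφ.map_one hφ'.map_one hx hx' hB hB' hF hF' (fun i k => by
    fin_cases i
    · exact (h1 k).trans (h1' k).symm
    · exact (h2 k).trans (h2' k).symm) n
  rw [h3, h3'] at this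
  exact_mod_cast this

theorem proposition18p09p06p1 (μ₁ μ₂ : Measure ℝ)
    (hp₁ : IsProbabilityMeasure μ₁) (hp₂ : IsProbabilityMeasure μ₂)
    (hs₁ : IsSymmetricMeasure μ₁) (hs₂ : IsSymmetricMeasure μ₂)
    (hc₁ : IsCompactlySupported μ₁) (hc₂ : IsCompactlySupported μ₂) :
    (∃! μ : Measure ℝ, IsRectFreeConvolution 0 μ₁ μ₂ μ) ∧
    (∃! ν : Measure ℝ, IsFreeConvolution (sqPush μ₁) (sqPush μ₂) ν) ∧
    (∀ μ : Measure ℝ, IsRectFreeConvolution 0 μ₁ μ₂ μ ↔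
      (IsProbabilityMeasure μ ∧ IsSymmetricMeasure μ ∧
        IsFreeConvolution (sqPush μ₁) (sqPush μ₂) (sqPush μ))) := by
  obtain ⟨μ, hμ⟩ := exists_isRectFreeConvolution μ₁ μ₂ hc₁ hc₂
  -- Gives both the uniqueness of the rectangular convolution and the converse implication: any
  -- symmetric `μ'` with the right square must be the convolution already constructed.
  have huniq : ∀ μ' : Measure ℝ, IsProbabilityMeasure μ' → IsSymmetricMeasure μ' →
      IsFreeConvolution (sqPush μ₁) (sqPush μ₂) (sqPush μ') → μ' = μ := by
    intro μ' hp hs h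
    have := hμ.1
    exact (hμ.2.2.1.ext_of_sqPush hs hμ.2.1 (hμ.isFreeConvolution.unique h)).symm
  refine ⟨⟨μ, hμ, fun μ' h => huniq μ' h.1 h.2.2.1 h.isFreeConvolution⟩,
    ⟨sqPush μ, hμ.isFreeConvolution, fun ν h => h.unique hμ.isFreeConvolution⟩, fun μ' => ?_⟩
  constructor
  · exact fun h => ⟨h.1, h.2.2.1, h.isFreeConvolution⟩
  · rintro ⟨hp, hs, h⟩
    rwa [huniq μ' hp hs h]
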